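/- **Setting.** Let $M_0=\mathbb Z[X]$ be the free abelian group with basis $b_i=X^i$ ($i\ge 0$). Let $r\ge 1$ and $n\ge 0$ be integers. Let $\mathcal P_{r,n}$ be the set of partitions $\lambda=(\lambda_1\ge\dots\ge\lambda_r\ge 0)$ with $\lambda_1\le n-r$ (empty if $n<r$), and put $[\mathbf b]^r_\lambda=b_{\lambda_r}\wedge b_{1+\lambda_{r-1}}\wedge\dots\wedge b_{r-1+\lambda_1}\in\bigwedge^rM_0$. A tensor in $\bigwedge^rM_0$ is *decomposable* if it equals $m_1\wedge\dots\wedge m_r$ for some $m_1,\dots,m_r\in M_0$. For $s\ge 0$ let $B_s=\mathbb Z[e_1,\dots,e_s]$ and $E_s(z)=1-e_1z+\dots+(-1)^se_sz^s$, and let $H_s=(h_j)_{j\in\mathbb Z}$ be defined by $\sum_{j\in\mathbb Z} h_jz^j=1/E_s(z)\in B_s[[z]]$ (so $h_j=0$ for $j<0$ and $h_0=1$). For a bilateral sequence $G=(g_j)_{j\in\mathbb Z}$ in a commutative ring and a partition $\lambda=(\lambda_1,\dots,\lambda_t)$ let $\Delta_\lambda(G)=\det(g_{\lambda_j-j+i})_{1\le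 i,j\le t}$. The map $\phi_s:B_s\to\bigwedge^sM_0$, $\Delta_\lambda(H_s)\mapsto[\mathbf b]^s_\lambda$ ($\lambda=(\lambda_1\ge\dots\ge\lambda_s\ge0)$), is an isomorphism of abelian groups. Let $\sigma_-(z),\overline\sigma_-(z):\bigwedge M_0\to(\bigwedge M_0)[z^{-1}]$ be the unique maps multiplicative for $\wedge$ (Hasse–Schmidt derivations) with $\sigma_-(z)b_j=\sum_{i=0}^jb_{j-i}z^{-i}$ and $\overline\sigma_-(z)b_j=b_j-b_{j-1}z^{-1}$ ($b_{-1}=0$); they are inverse to each other. Through $\phi_s$ they induce maps $\sigma_-(z),\overline\sigma_-(z):B_s\to B_s[z^{-1}]$. Put $\sigma_-(z)H_s=(\sigma_-(z)h_j)_{j}$ and $\overline\sigma_-(z)H_s=(\overline\sigma_-(z)h_j)_{j}$; for $s=0$ the $j$-th term of $\sigma_-(z)H_0$ is by convention $z^{-j}$ if $j\ge0$ and $0$ if $j<0$. Let $B_{s,n}=B_s/(h_{n-s+1},\dots,h_n)$, where the generators are terms of $H_s$; thus $B_{r-1,n}=B_{r-1}/(h_{n-r+2},\dots,h_n)$ and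 $B_{r+1,n}=B_{r+1}/(h_{n-r},\dots,h_n)$. Write $\sigma_-(z)H_{s,n}$, $\overline\sigma_-(z)H_{s,n}$ for the termwise images of $\sigma_-(z)H_s$, $\overline\sigma_-(z)H_s$ in $B_{s,n}((z))$, write $\overline\sigma_-(z)\Delta_\mu(H_{s,n})$ for the image of $\overline\sigma_-(z)\Delta_\mu(H_s)$ in $B_{s,n}((z))$, and write $E_s(z)$, $1/E_s(z)$ also for their images in $B_{s,n}((z))$. For sequences attached to $s=r+1$, a partition $\mu\in\mathcal P_{r,n}$ is read as $(\mu_1,\dots,\mu_r,0)$. Let $\mathrm{Res}_z$ be the coefficient of $z^{-1}$. **Corollary.** Let $(a_\lambda)_{\lambda\in\mathcal P_{r,n}}$ be integers. The following are equivalent. 1. The tensor $\sum_{\lambda\in\mathcal P_{r,n}}a_\lambda[\mathbf b]^r_\lambda\in\bigwedge^rM_0$ is decomposable. 2. In $(B_{r-1,n}\otimes_{\mathbb Z}B_{r+1,n})((z))$, $$\mathrm{Res}_z\sum_{\lambda,\mu\in\mathcal P_{r,n}}a_\lambda a_\mu\,E_{r-1}(z)\Delta_\lambda(\sigma_-(z)H_{r-1,n})\otimes\frac1{E_{r+1}(z)}\Delta_\mu(\overline\sigma_-(z)H_{r+1,n})=0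 .$$ 3. Marking with $'$ and $''$ the images in $(B_{r-1,n}\otimes_{\mathbb Z}B_{r+1,n})((z))$ of elements of $B_{r-1,n}((z))$ and $B_{r+1,n}((z))$ respectively, $$\mathrm{Res}_z\,\frac{E'_{r-1}(z)}{E''_{r+1}(z)}\sum_{\lambda,\mu\in\mathcal P_{r,n}}a_\lambda a_\mu\,\Delta_\lambda(\sigma_-(z)H'_{r-1,n})\cdot\overline\sigma_-(z)\Delta_\mu(H''_{r+1,n})=0 .$$ -/

import Mathlib

open scoped TensorProduct

namespace SchubertDerivation

noncomputable section

/-! ### The free abelian group `M₀ = ℤ[X]` and its exterior algebra -/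

/-- The free abelian group `M₀ = ℤ[X]`, with basis `b_i = X ^ i`. -/
abbrev M0 : Type := Polynomial ℤ

/-- The basis element `b_i = X ^ i` of `M₀`. -/
def b (i : ℕ) : M0 := Polynomial.X ^ i

/-- The exterior algebra `⋀ M₀`. -/
abbrev Ext : Type := ExteriorAlgebra ℤ M0

/-- The polynomials in `(⋀ M₀)[w]` all of whose coefficients lie in `M₀ ⊆ ⋀ M₀`. -/
def degOne : Submodule ℤ (Polynomial Ext) where
  carrier := {p | ∀ i, p.coeff i ∈ LinearMap.range (ExteriorAlgebra.ι ℤ : M0 →ₗ[ℤ] Ext)}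
  add_mem' {p q} hp hq i := by
    rw [Polynomial.coeff_add]; exact Submodule.add_mem _ (hp i) (hq i)
  zero_mem' i := by
    rw [Polynomial.coeff_zero]; exact Submodule.zero_mem _
  smul_mem' c p hp i := by
    rw [Polynomial.coeff_smul]; exact Submodule.smul_mem _ c (hp i)

theorem degOne_mul_self {p : Polynomial Ext} (hp : p ∈ degOne) : p * p = 0 := by
  ext n
  rw [Polynomial.coeff_mul, Polynomial.coeff_zero]
  refine Finset.sum_involution (fun x _ => x.swap) ?_ ?_ ?_ ?_
  · rintro ⟨i, j⟩ _
    obtain ⟨u, hu⟩ := hp i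
    obtain ⟨v, hv⟩ := hp j
    simp only [Prod.fst_swap, Prod.snd_swap, ← hu, ← hv]
    exact ExteriorAlgebra.ι_add_mul_swap u v
  · rintro ⟨i, j⟩ _ hne heq
    have hij : j = i := congrArg Prod.fst heq
    subst hij
    obtain ⟨u, hu⟩ := hp j
    apply hne
    simp only [← hu]
    exact ExteriorAlgebra.ι_sq_zero u
  · rintro ⟨i, j⟩ h
    simpa [add_comm] using h
  · rintro ⟨i, j⟩ _
    rfl

/-- The linear map `M₀ → (⋀ M₀)[w]` with `b_j ↦ f j`. -/
def genMap (f : ℕ → Polynomial Ext) : M0 →ₗ[ℤ] Polynomial Ext :=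
  (Polynomial.basisMonomials ℤ).constr ℤ f

theorem genMap_mem (f : ℕ → Polynomial Ext) (hf : ∀ j, f j ∈ degOne) (m : M0) :
    genMap f m ∈ degOne := by
  rw [genMap, Module.Basis.constr_apply]
  exact Submodule.sum_mem _ fun j _ => Submodule.smul_mem _ _ (hf j)

/-- The unique Hasse–Schmidt derivation (multiplicative map) `⋀ M₀ → (⋀ M₀)[w]`
with `b_j ↦ f j`. The variable `w` stands for `z⁻¹`. -/
def hsDerivation (f : ℕ → Polynomial Ext) (hf : ∀ j, f j ∈ degOne) :
    Ext →ₐ[ℤ] Polynomial Ext :=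
  ExteriorAlgebra.lift ℤ ⟨genMap f, fun m => degOne_mul_self (genMap_mem f hf m)⟩

theorem monomial_mem_degOne (i : ℕ) (m : M0) :
    Polynomial.monomial i (ExteriorAlgebra.ι ℤ m) ∈ degOne := by
  intro k
  rw [Polynomial.coeff_monomial]
  split_ifs
  · exact ⟨m, rfl⟩
  · exact Submodule.zero_mem _

/-- The values `σ₋(z) b_j = ∑_{i ≤ j} b_{j-i} z⁻ⁱ`. -/
def sigmaGen (j : ℕ) : Polynomial Ext :=
  ∑ i ∈ Finset.range (j + 1), Polynomial.monomial i (ExteriorAlgebra.ι ℤ (b (j - i)))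

/-- The values `σ̄₋(z) b_j = b_j - b_{j-1} z⁻¹`, where `b_{-1} = 0`. -/
def sigmaBarGen (j : ℕ) : Polynomial Ext :=
  Polynomial.monomial 0 (ExteriorAlgebra.ι ℤ (b j)) -
    if j = 0 then 0 else Polynomial.monomial 1 (ExteriorAlgebra.ι ℤ (b (j - 1)))

theorem sigmaGen_mem (j : ℕ) : sigmaGen j ∈ degOne :=
  Submodule.sum_mem _ fun _ _ => monomial_mem_degOne _ _

theorem sigmaBarGen_mem (j : ℕ) : sigmaBarGen j ∈ degOne := by
  refine Submodule.sub_mem _ (monomial_mem_degOne _ _) ?_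
  split_ifs
  · exact Submodule.zero_mem _
  · exact monomial_mem_degOne _ _

/-- The Schubert derivation `σ₋(z) : ⋀ M₀ → (⋀ M₀)[z⁻¹]`. -/
def sigmaMinus : Ext →ₐ[ℤ] Polynomial Ext := hsDerivation sigmaGen sigmaGen_mem

/-- The inverse Schubert derivation `σ̄₋(z) : ⋀ M₀ → (⋀ M₀)[z⁻¹]`. -/
def sigmaBarMinus : Ext →ₐ[ℤ] Polynomial Ext := hsDerivation sigmaBarGen sigmaBarGen_mem

/-! ### Partitions, the basis of `⋀ʳ M₀`, decomposable tensors -/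

/-- The set `𝒫_{r,n}` of partitions `λ₁ ≥ … ≥ λ_r ≥ 0` with `λ₁ ≤ n - r` (as integers, so it is
empty if `n < r`). The entry `λ_{i+1}` is `lam i`. -/
def boundedPartitions (r n : ℕ) : Finset (Fin r → ℕ) :=
  open Classical in
  (Fintype.piFinset fun _ => Finset.range (n + 1)).filter
    fun lam => Antitone lam ∧ ∀ i, lam i + r ≤ n

/-- The basis element `[b]^r_λ = b_{λ_r} ∧ b_{1+λ_{r-1}} ∧ ⋯ ∧ b_{r-1+λ₁}` of `⋀ʳ M₀`. -/
def wedge {r : ℕ} (lam : Fin r → ℕ) : ⋀[ℤ]^r M0 :=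
  exteriorPower.ιMulti ℤ r fun k : Fin r => b (k + lam k.rev)

/-- Membership in the Grassmann cone: `m = m₁ ∧ ⋯ ∧ m_r` for some `m_i ∈ M₀`. -/
def IsDecomposable {r : ℕ} (m : ⋀[ℤ]^r M0) : Prop :=
  ∃ v : Fin r → M0, exteriorPower.ιMulti ℤ r v = m

/-! ### The polynomial ring `B_r` -/

/-- `B_r = ℤ[e_1, …, e_r]`; the indeterminate `e_{i+1}` is `MvPolynomial.X i`. -/
abbrev B (r : ℕ) : Type := MvPolynomial (Fin r) ℤ

/-- `E_r(z) = 1 - e_1 z + ⋯ + (-1)^r e_r z^r`, as a power series. -/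
def E (r : ℕ) : PowerSeries (B r) :=
  1 + ∑ i : Fin r, PowerSeries.monomial (i + 1) ((-1) ^ (i + 1 : ℕ) * MvPolynomial.X i)

/-- The inverse `1 / E_r(z)` in `B_r[[z]]`. -/
def invE (r : ℕ) : PowerSeries (B r) := PowerSeries.invOfUnit (E r) 1

theorem E_mul_invE (r : ℕ) : E r * invE r = 1 := by
  apply PowerSeries.mul_invOfUnit
  rw [← PowerSeries.coeff_zero_eq_constantCoeff_apply, E, map_add, map_sum]
  rw [Finset.sum_eq_zero fun i _ => by rw [PowerSeries.coeff_monomial, if_neg (by omega)]]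
  simp

/-- The bilateral sequence `H_r = (h_j)_{j ∈ ℤ}`, with `∑ h_j z^j = 1 / E_r(z)`. -/
def h (r : ℕ) (j : ℤ) : B r := if j < 0 then 0 else PowerSeries.coeff j.toNat (invE r)

/-- The Schur determinant `Δ_λ(g) = det (g_{λ_j - j + i})_{1 ≤ i, j ≤ s}` of a bilateral sequence
`g` and of `λ = (λ₁, …, λ_s)`. -/
def schurDet {R : Type*} [CommRing R] {s : ℕ} (lam : Fin s → ℕ) (g : ℤ → R) : R :=
  Matrix.det (Matrix.of fun i j : Fin s => g ((lam j : ℤ) - (j : ℤ) + (i : ℤ)))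

/-- The linear map `M₀ → B_r^r` given by `b_c ↦ (h_c, h_{c-1}, …, h_{c-r+1})`. -/
def hRow (r : ℕ) : M0 →ₗ[ℤ] (Fin r → B r) :=
  (Polynomial.basisMonomials ℤ).constr ℤ fun c => fun l : Fin r => h r ((c : ℤ) - (l : ℤ))

/-- The alternating map sending `(m_1, …, m_r)` to the determinant with rows `hRow r m_i`. -/
def hAlt (r : ℕ) : M0 [⋀^Fin r]→ₗ[ℤ] B r :=
  { ((Matrix.detRowAlternating (n := Fin r)
      (R := B r)).toMultilinearMap.restrictScalars ℤ).compLinearMap (fun _ => hRow r) with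
    map_eq_zero_of_eq' := fun v _ _ hv hij =>
      Matrix.detRowAlternating.map_eq_zero_of_eq (fun k => hRow r (v k))
        (congrArg (hRow r) hv) hij }

/-- The inverse of the isomorphism `φ_r : B_r → ⋀ʳ M₀`, extended by zero to the components of
`⋀ M₀` of degree different from `r`: it maps `m_1 ∧ ⋯ ∧ m_r` to the determinant of the matrix
with rows `hRow r m_i`, hence `[b]^r_λ` to `Δ_λ(H_r)`, see `phiInv_wedge`. -/
def phiInv (r : ℕ) : Ext →ₗ[ℤ] B r :=
  ExteriorAlgebra.liftAlternating
    (Pi.single (M := fun i => M0 [⋀^Fin i]→ₗ[ℤ] B r) r (hAlt r))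

theorem phiInv_wedge {r : ℕ} (lam : Fin r → ℕ) :
    phiInv r (wedge lam : Ext) = schurDet lam (h r) := by
  have key : ∀ c : ℕ, hRow r (b c) = fun l : Fin r => h r ((c : ℤ) - (l : ℤ)) := by
    intro c
    have hb : b c = Polynomial.basisMonomials ℤ c := by
      simp [b, Polynomial.X_pow_eq_monomial]
    rw [hb, hRow, Module.Basis.constr_basis]
  rw [wedge, exteriorPower.ιMulti_apply_coe, phiInv, ExteriorAlgebra.liftAlternating_apply_ιMulti,
    Pi.single_eq_same, schurDet]
  change Matrix.det (Matrix.of fun k : Fin r => hRow r (b (k + lam k.rev))) = _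
  rw [← Matrix.det_transpose, ← Matrix.det_submatrix_equiv_self (Fin.revPerm (n := r))]
  congr 1
  ext1 i j
  simp only [Matrix.submatrix_apply, Matrix.transpose_apply, Matrix.of_apply, Fin.revPerm_apply]
  rw [key, Fin.rev_rev]
  refine congrArg (h r) ?_
  have hi := Fin.val_rev i
  have hj := Fin.val_rev j
  have hi' := i.isLt
  have hj' := j.isLt
  simp only [Nat.cast_add]
  omega

/-- The isomorphism of abelian groups `φ_r : B_r → ⋀ʳ M₀` with `Δ_λ(H_r) ↦ [b]^r_λ`: the inverse
of the bijection `⋀ʳ M₀ → B_r`, `[b]^r_λ ↦ Δ_λ(H_r)`. -/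
def phi (r : ℕ) : B r → ⋀[ℤ]^r M0 := Function.invFun fun m : ⋀[ℤ]^r M0 => phiInv r (m : Ext)

/-- For an operator `D : ⋀ M₀ → (⋀ M₀)[z⁻¹]`, the operator `φ_r⁻¹ ∘ D ∘ φ_r : B_r → B_r[z⁻¹]`,
with `φ_r⁻¹` applied coefficientwise. -/
def transport (r : ℕ) (D : Ext →ₐ[ℤ] Polynomial Ext) (p : B r) : Polynomial (B r) :=
  (D (phi r p : Ext)).sum fun i m => Polynomial.monomial i (phiInv r m)

/-- `σ₋(z) : B_r → B_r[z⁻¹]`. -/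
def sigmaMinusB (r : ℕ) : B r → Polynomial (B r) := transport r sigmaMinus

/-- `σ̄₋(z) : B_r → B_r[z⁻¹]`. -/
def sigmaBarMinusB (r : ℕ) : B r → Polynomial (B r) := transport r sigmaBarMinus

/-- The bilateral sequence `σ₋(z) H_r = (σ₋(z) h_j)_{j ∈ ℤ}`. By convention, for `r = 0` the
`j`-th term is `z⁻ʲ` if `j ≥ 0` (and `0` if `j < 0`). -/
def sigmaMinusH (r : ℕ) (j : ℤ) : Polynomial (B r) :=
  if r = 0 then (if j < 0 then 0 else Polynomial.X ^ j.toNat) else sigmaMinusB r (h r j)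

/-- The bilateral sequence `σ̄₋(z) H_r = (σ̄₋(z) h_j)_{j ∈ ℤ}` (used only for `r ≥ 1`). -/
def sigmaBarMinusH (r : ℕ) (j : ℤ) : Polynomial (B r) := sigmaBarMinusB r (h r j)

/-! ### The truncated rings `B_{r,n}` -/

/-- The ideal `I_{r,n} = (h_{n-r+1}, …, h_n)` of `B_r`. -/
def truncIdeal (r n : ℕ) : Ideal (B r) :=
  Ideal.span (h r '' Set.Icc ((n : ℤ) - (r : ℤ) + 1) (n : ℤ))

/-- `B_{r,n} = B_r / (h_{n-r+1}, …, h_n)`. -/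
abbrev BT (r n : ℕ) : Type := B r ⧸ truncIdeal r n

/-- The projection `B_r → B_{r,n}`. -/
def proj (r n : ℕ) : B r →+* BT r n := Ideal.Quotient.mk (truncIdeal r n)

/-- The ring homomorphism `B_r[z⁻¹] → B_{r,n}((z))`: reduction of the coefficients. -/
def toLaurent (r n : ℕ) : Polynomial (B r) →+* LaurentSeries (BT r n) :=
  Polynomial.eval₂RingHom ((HahnSeries.C : BT r n →+* LaurentSeries (BT r n)).comp (proj r n))
    (HahnSeries.single (-1 : ℤ) (1 : BT r n))

/-- The image of `E_r(z)` in `B_{r,n}((z))`. -/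
def ET (r n : ℕ) : LaurentSeries (BT r n) :=
  HahnSeries.ofPowerSeries ℤ (BT r n) (PowerSeries.map (proj r n) (E r))

/-- The image of `1 / E_r(z)` in `B_{r,n}((z))`. -/
def invET (r n : ℕ) : LaurentSeries (BT r n) :=
  HahnSeries.ofPowerSeries ℤ (BT r n) (PowerSeries.map (proj r n) (invE r))

/-- The sequence `σ₋(z) H_{r,n}` in `B_{r,n}((z))`: the classes of the `σ₋(z) h_j`. -/
def sigmaMinusHT (r n : ℕ) (j : ℤ) : LaurentSeries (BT r n) := toLaurent r n (sigmaMinusH r j)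

/-- The sequence `σ̄₋(z) H_{r,n}` in `B_{r,n}((z))`: the classes of the `σ̄₋(z) h_j`. -/
def sigmaBarMinusHT (r n : ℕ) (j : ℤ) : LaurentSeries (BT r n) :=
  toLaurent r n (sigmaBarMinusH r j)

/-- `R((z)) → (R ⊗ S)((z))`, `f ↦ f ⊗ 1` on coefficients. -/
def left (R S : Type*) [CommRing R] [CommRing S] (f : LaurentSeries R) :
    LaurentSeries (R ⊗[ℤ] S) :=
  HahnSeries.map f (Algebra.TensorProduct.includeLeft : R →ₐ[ℤ] R ⊗[ℤ] S)

/-- `S((z)) → (R ⊗ S)((z))`, `g ↦ 1 ⊗ g` on coefficients. -/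
def right (R S : Type*) [CommRing R] [CommRing S] (g : LaurentSeries S) :
    LaurentSeries (R ⊗[ℤ] S) :=
  HahnSeries.map g (Algebra.TensorProduct.includeRight : S →ₐ[ℤ] R ⊗[ℤ] S)

/-- The tensor product `f ⊗ g ∈ (R ⊗ S)((z))` of `f ∈ R((z))` and `g ∈ S((z))`. -/
def tens {R S : Type*} [CommRing R] [CommRing S] (f : LaurentSeries R) (g : LaurentSeries S) :
    LaurentSeries (R ⊗[ℤ] S) :=
  left R S f * right R S g

/-- The residue: the coefficient of `z⁻¹`. -/
def res {R : Type*} [CommRing R] (f : LaurentSeries R) : R := HahnSeries.coeff f (-1)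

/-- A partition `(μ₁, …, μ_r) ∈ 𝒫_r`, seen as `(μ₁, …, μ_r, 0) ∈ 𝒫_{r+1}`. -/
def extend {r : ℕ} (mu : Fin r → ℕ) : Fin (r + 1) → ℕ := Fin.snoc (α := fun _ => ℕ) mu 0

end

end SchubertDerivation

open SchubertDerivation

/-!
Let `β_i` be the form dual to `b_i`. The vanishing of the Plücker tensor `∑_i (β_i ⌟ x) ⊗ (b_i ∧ x)`
characterizes the decomposable tensors `x`. Indeed, applying a linear form to its first factor gives
some `w ≠ 0` with `w ∧ x = 0`; dividing `w` by its content gives `v` with `v ∧ x = 0` and a linear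
form `f` with `f v = 1`, so that `x = v ∧ (f ⌟ x)`, and one concludes by induction on the degree,
since the Plücker tensor of `f ⌟ x` vanishes too.

Read through the isomorphisms `φ_s`, the vertex operators `E_{r-1}(z) σ₋(z)` and
`E_{r+1}(z)⁻¹ σ̄₋(z)` are, up to sign and powers of `z`, the generating series of the contractions
by the `β_i` and of the products by the `b_i`. The residue of their tensor product is therefore, up
to sign, the Plücker tensor. The relations defining `B_{s,n}` only involve wedges containing some
`b_j` with `j ≥ n`, so that nothing is lost for tensors supported on `b_0, …, b_{n-1}`.
-/

namespace SchubertDerivation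

noncomputable section

/-! ### Contractions and alternating forms -/

section ExteriorAlgebra

open ExteriorAlgebra (ι ιMulti)

variable {R M : Type*} [CommRing R] [AddCommGroup M] [Module R M]

/-- The contraction (interior product) `f ⌟ x`: the antiderivation of `⋀ M` extending the linear
form `f` on `M`. -/
def contract : Module.Dual R M →ₗ[R] ExteriorAlgebra R M →ₗ[R] ExteriorAlgebra R M :=
  CliffordAlgebra.contractLeft (Q := (0 : QuadraticForm R M))

theorem contract_ι_mul (f : Module.Dual R M) (v : M) (x : ExteriorAlgebra R M) :
    contract f (ι R v * x) = f v • x - ι R v * contract f x :=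
  CliffordAlgebra.contractLeft_ι_mul _ _ _

theorem contract_algebraMap (f : Module.Dual R M) (a : R) : contract f (algebraMap R _ a) = 0 :=
  CliffordAlgebra.contractLeft_algebraMap _ _ _

theorem contract_one (f : Module.Dual R M) : contract f 1 = 0 :=
  CliffordAlgebra.contractLeft_one _ _

theorem contract_contract (f : Module.Dual R M) (x : ExteriorAlgebra R M) :
    contract f (contract f x) = 0 :=
  CliffordAlgebra.contractLeft_contractLeft _ _

theorem contract_comm (f g : Module.Dual R M) (x : ExteriorAlgebra R M) :
    contract f (contract g x) = -contract g (contract f x) :=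
  CliffordAlgebra.contractLeft_comm _ _ _

theorem contract_ιMulti (f : Module.Dual R M) {s : ℕ} (v : Fin (s + 1) → M) :
    contract f (ιMulti R (s + 1) v) =
      ∑ k : Fin (s + 1), ((-1) ^ (k : ℕ) * f (v k)) • ιMulti R s (fun j => v (k.succAbove j)) := by
  induction s with
  | zero =>
    rw [ExteriorAlgebra.ιMulti_succ_apply, contract_ι_mul]
    simp [contract_one]
  | succ s ih =>
    rw [ExteriorAlgebra.ιMulti_succ_apply, contract_ι_mul, Matrix.vecTail, ih,
      Fin.sum_univ_succ (n := s + 1), Finset.mul_sum, sub_eq_add_neg, ← Finset.sum_neg_distrib]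
    congr 1
    · simp only [Fin.val_zero, pow_zero, one_mul, Fin.zero_succAbove]
      rfl
    · refine Finset.sum_congr rfl fun k _ => ?_
      rw [ExteriorAlgebra.ιMulti_succ_apply (n := s), mul_smul_comm, ← neg_smul]
      congr 1
      · simp [pow_succ]
      · rw [Fin.succ_succAbove_zero]
        congr 2
        ext j : 1
        exact congrArg v (Fin.succ_succAbove_succ k j).symm

theorem contract_mem {s : ℕ} {x : ExteriorAlgebra R M} (hx : x ∈ ⋀[R]^(s + 1) M)
    (f : Module.Dual R M) : contract f x ∈ ⋀[R]^s M := by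
  rw [← exteriorPower.ιMulti_span_fixedDegree] at hx
  refine (Submodule.span_le (p := (⋀[R]^s M).comap (contract f))).2 ?_ hx
  rintro _ ⟨v, rfl⟩
  rw [SetLike.mem_coe, Submodule.mem_comap, contract_ιMulti]
  exact Submodule.sum_mem _ fun k _ => Submodule.smul_mem _ _
    (exteriorPower.ιMulti R s fun j => v (k.succAbove j)).2

theorem ι_mul_mem {s : ℕ} {x : ExteriorAlgebra R M} (hx : x ∈ ⋀[R]^s M) (v : M) :
    ι R v * x ∈ ⋀[R]^(s + 1) M := by
  rw [ExteriorAlgebra.exteriorPower, pow_succ']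
  exact Submodule.mul_mem_mul ⟨v, rfl⟩ hx

/-- The linear form `f_1 ∧ ⋯ ∧ f_s` on `⋀ M`: it vanishes in degrees other than `s`, and maps
`v_1 ∧ ⋯ ∧ v_s` to `det (f_l (v_k))`. -/
def exteriorForm {s : ℕ} (f : Fin s → Module.Dual R M) : ExteriorAlgebra R M →ₗ[R] R :=
  ExteriorAlgebra.liftAlternating <| Pi.single (M := fun i => M [⋀^Fin i]→ₗ[R] R) s <|
    (Matrix.detRowAlternating (n := Fin s) (R := R)).compLinearMap (LinearMap.pi f)

theorem exteriorForm_ιMulti {s : ℕ} (f : Fin s → Module.Dual R M) (v : Fin s → M) :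
    exteriorForm f (ιMulti R s v) = Matrix.det (Matrix.of fun k l => f l (v k)) := by
  rw [exteriorForm, ExteriorAlgebra.liftAlternating_apply_ιMulti, Pi.single_eq_same]
  rfl

theorem linearMap_eqOn_exteriorPower {N : Type*} [AddCommGroup N] [Module R N] {s : ℕ}
    {F G : ExteriorAlgebra R M →ₗ[R] N}
    (hFG : ∀ v : Fin s → M, F (ιMulti R s v) = G (ιMulti R s v)) {x : ExteriorAlgebra R M}
    (hx : x ∈ ⋀[R]^s M) : F x = G x := by
  rw [← exteriorPower.ιMulti_span_fixedDegree] at hx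
  refine LinearMap.eqOn_span ?_ hx
  rintro _ ⟨v, rfl⟩
  exact hFG v

theorem exteriorForm_contract {s : ℕ} (f : Fin (s + 1) → Module.Dual R M)
    {x : ExteriorAlgebra R M} (hx : x ∈ ⋀[R]^(s + 1) M) :
    exteriorForm (fun l => f l.succ) (contract (f 0) x) = exteriorForm f x := by
  refine linearMap_eqOn_exteriorPower
    (F := (exteriorForm fun l => f l.succ) ∘ₗ contract (f 0)) (fun v => ?_) hx
  rw [LinearMap.comp_apply, contract_ιMulti, exteriorForm_ιMulti, Matrix.det_succ_column_zero,
    map_sum]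
  refine Finset.sum_congr rfl fun k _ => ?_
  rw [map_smul, exteriorForm_ιMulti, smul_eq_mul]
  rfl

variable {κ : Type*} (e : Module.Basis κ R M)

theorem exteriorPower_repr_eq_exteriorForm [LinearOrder κ] {s : ℕ} (x : ⋀[R]^s M)
    (t : Set.powersetCard κ s) :
    (e.exteriorPower s).repr x t =
      exteriorForm (fun k => e.coord (Set.powersetCard.ofFinEmbEquiv.symm t k)) (x : _) := by
  rw [exteriorPower.basis_repr_apply]
  suffices exteriorPower.ιMultiDual R s e t = exteriorForm
      (fun k => e.coord (Set.powersetCard.ofFinEmbEquiv.symm t k)) ∘ₗ Submodule.subtype _ from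
    LinearMap.congr_fun this x
  ext v
  simp only [LinearMap.compAlternatingMap_apply, exteriorPower.ιMultiDual_apply_ιMulti,
    LinearMap.comp_apply, Submodule.subtype_apply, exteriorPower.ιMulti_apply_coe,
    exteriorForm_ιMulti]

theorem linearMap_eqOn_exteriorPower_of_basis {N : Type*} [AddCommGroup N] [Module R N] {s : ℕ}
    {F G : ExteriorAlgebra R M →ₗ[R] N}
    (hFG : ∀ c : Fin s → κ, F (ιMulti R s fun k => e (c k)) = G (ιMulti R s fun k => e (c k)))
    {x : ExteriorAlgebra R M} (hx : x ∈ ⋀[R]^s M) : F x = G x :=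
  linearMap_eqOn_exteriorPower (fun v => congrArg (fun A => A v) <|
    e.ext_alternating (f := F.compAlternatingMap (ιMulti R s))
      (g := G.compAlternatingMap (ιMulti R s)) fun c _ => hFG c) hx

theorem exists_exteriorForm_coord_ne_zero {s : ℕ} {x : ExteriorAlgebra R M}
    (hx : x ∈ ⋀[R]^s M) (h0 : x ≠ 0) :
    ∃ c : Fin s → κ, exteriorForm (fun k => e.coord (c k)) x ≠ 0 := by
  classical
  let : LinearOrder κ := linearOrderOfSTO WellOrderingRel
  contrapose! h0
  suffices (⟨x, hx⟩ : ⋀[R]^s M) = 0 from congrArg Subtype.val this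
  refine (e.exteriorPower s).ext_elem fun t => ?_
  rw [exteriorPower_repr_eq_exteriorForm, h0, map_zero, Finsupp.zero_apply]

/-! ### Supports -/

/-- The elements of `⋀ M` which are supported on the span of the basis vectors `e i`, `i ∈ J`:
the contraction by a linear form `f` depends only on the values `f (e i)`, `i ∈ J`. -/
def supported (J : Finset κ) : Submodule R (ExteriorAlgebra R M) :=
  ⨅ f : Module.Dual R M,
    LinearMap.eqLocus (contract f) (∑ i ∈ J, f (e i) • contract (e.coord i))

variable {e} {J K : Finset κ} {x : ExteriorAlgebra R M}

theorem mem_supported :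
    x ∈ supported e J ↔
      ∀ f : Module.Dual R M, contract f x = ∑ i ∈ J, f (e i) • contract (e.coord i) x := by
  simp [supported]

theorem contract_coord_eq_zero (hx : x ∈ supported e J) {i : κ} (hi : i ∉ J) :
    contract (e.coord i) x = 0 := by
  rw [mem_supported.1 hx]
  refine Finset.sum_eq_zero fun j hj => ?_
  rw [Module.Basis.coord_apply, Module.Basis.repr_self,
    Finsupp.single_eq_of_ne (ne_of_mem_of_not_mem hj hi).symm, zero_smul]

theorem supported_mono (hJK : J ⊆ K) : supported e J ≤ supported e K := fun _ hx =>
  mem_supported.2 fun f => by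
    rw [mem_supported.1 hx f]
    exact Finset.sum_subset hJK fun i _ hi => by rw [contract_coord_eq_zero hx hi, smul_zero]

theorem contract_mem_supported (hx : x ∈ supported e J) (f : Module.Dual R M) :
    contract f x ∈ supported e J := by
  refine mem_supported.2 fun g => ?_
  simp_rw [contract_comm _ f, smul_neg, Finset.sum_neg_distrib]
  rw [mem_supported.1 hx g, map_sum]
  simp_rw [map_smul]

theorem sum_coord_smul_of_support_subset {v : M} (hv : (e.repr v).support ⊆ J) :
    ∑ i ∈ J, e.coord i v • e i = v := by
  conv_rhs => rw [← e.linearCombination_repr v, Finsupp.linearCombination_apply,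
    Finsupp.sum_of_support_subset _ hv _ fun i _ => zero_smul R (e i)]
  rfl

theorem ι_mul_mem_supported (hx : x ∈ supported e J) {v : M}
    (hv : (e.repr v).support ⊆ J) : ι R v * x ∈ supported e J := by
  refine mem_supported.2 fun f => ?_
  simp_rw [contract_ι_mul, smul_sub, ← mul_smul_comm, Finset.sum_sub_distrib, ← Finset.mul_sum]
  rw [← mem_supported.1 hx f]
  congr 1
  conv_lhs => rw [← sum_coord_smul_of_support_subset hv, map_sum, Finset.sum_smul]
  simp_rw [map_smul, smul_eq_mul, mul_comm (e.coord _ v), mul_smul]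

theorem algebraMap_mem_supported (a : R) : algebraMap R _ a ∈ supported e J :=
  mem_supported.2 fun f => by simp_rw [contract_algebraMap, smul_zero, Finset.sum_const_zero]

theorem ιMulti_mem_supported {s : ℕ} {v : Fin s → M} (hv : ∀ k, (e.repr (v k)).support ⊆ J) :
    ιMulti R s v ∈ supported e J := by
  induction s with
  | zero => simpa using algebraMap_mem_supported (e := e) (J := J) (1 : R)
  | succ s ih =>
    rw [ExteriorAlgebra.ιMulti_succ_apply]
    exact ι_mul_mem_supported (ih fun k => hv k.succ) (hv 0)

theorem ιMulti_basis_mem_supported {s : ℕ} {c : Fin s → κ} (hc : ∀ k, c k ∈ J) :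
    ιMulti R s (fun k => e (c k)) ∈ supported e J :=
  ιMulti_mem_supported fun k => by
    rw [e.repr_self]
    exact Finsupp.support_single_subset.trans (Finset.singleton_subset_iff.2 (hc k))

theorem exteriorForm_coord_eq_zero {s : ℕ} (hxs : x ∈ ⋀[R]^s M) (hx : x ∈ supported e J)
    {c : Fin s → κ} {k : Fin s} (hk : c k ∉ J) : exteriorForm (fun l => e.coord (c l)) x = 0 := by
  induction s generalizing x with
  | zero => exact k.elim0
  | succ s ih =>
    rw [← exteriorForm_contract _ hxs]
    cases k using Fin.cases with
    | zero => rw [contract_coord_eq_zero hx hk, map_zero]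
    | succ k =>
      exact ih (contract_mem hxs _) (contract_mem_supported hx _) (c := fun l => c l.succ) hk

open Classical in
theorem sum_exteriorForm_smul_ιMulti [LinearOrder κ] {s : ℕ} (hxs : x ∈ ⋀[R]^s M)
    (hx : x ∈ supported e J) :
    ∑ t ∈ (J.powersetCard s).subtype (· ∈ Set.powersetCard κ s),
      exteriorForm (fun k => e.coord (Set.powersetCard.ofFinEmbEquiv.symm t k)) x •
        ιMulti R s (fun k => e (Set.powersetCard.ofFinEmbEquiv.symm t k)) = x := by
  have hsupp : ((e.exteriorPower s).repr ⟨x, hxs⟩).support ⊆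
      (J.powersetCard s).subtype (· ∈ Set.powersetCard κ s) := fun t ht => by
    rw [Finset.mem_subtype, Finset.mem_powersetCard]
    refine ⟨fun i hi => ?_, t.2⟩
    obtain ⟨k, rfl⟩ := (Set.powersetCard.mem_range_ofFinEmbEquiv_symm_iff_mem t i).2 hi
    contrapose! ht
    rw [Finsupp.notMem_support_iff, exteriorPower_repr_eq_exteriorForm]
    exact exteriorForm_coord_eq_zero hxs hx ht
  have hrepr := (e.exteriorPower s).linearCombination_repr ⟨x, hxs⟩
  rw [Finsupp.linearCombination_apply, Finsupp.sum_of_support_subset _ hsupp _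
    fun t _ => zero_smul R (e.exteriorPower s t)] at hrepr
  have hcoe := congrArg Subtype.val hrepr
  simp only [Submodule.coe_sum, Submodule.coe_smul, exteriorPower_repr_eq_exteriorForm,
    exteriorPower.basis_apply, exteriorPower.ιMulti_family_apply_coe] at hcoe
  exact hcoe

variable (e) in
theorem exists_mem_supported (x : ExteriorAlgebra R M) : ∃ J : Finset κ, x ∈ supported e J := by
  classical
  induction x using CliffordAlgebra.left_induction with
  | algebraMap a => exact ⟨∅, algebraMap_mem_supported a⟩
  | add x y hx hy =>
    obtain ⟨J, hJ⟩ := hx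
    obtain ⟨K, hK⟩ := hy
    exact ⟨J ∪ K, Submodule.add_mem _ (supported_mono Finset.subset_union_left hJ)
      (supported_mono Finset.subset_union_right hK)⟩
  | ι_mul x v hx =>
    obtain ⟨J, hJ⟩ := hx
    exact ⟨J ∪ (e.repr v).support, ι_mul_mem_supported
      (supported_mono Finset.subset_union_left hJ) Finset.subset_union_right⟩

/-! ### The Plücker tensor -/

variable (e) in
/-- The Plücker tensor `∑ᵢ (eᵢ* ⌟ x) ⊗ (eᵢ ∧ x)` of `x ∈ ⋀ M`. The sum has finite support, see
`pluckerTensor_eq_sum`. -/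
def pluckerTensor (x : ExteriorAlgebra R M) : ExteriorAlgebra R M ⊗[R] ExteriorAlgebra R M :=
  ∑ᶠ i, contract (e.coord i) x ⊗ₜ[R] (ι R (e i) * x)

theorem pluckerTensor_eq_sum (hx : x ∈ supported e J) :
    pluckerTensor e x = ∑ i ∈ J, contract (e.coord i) x ⊗ₜ[R] (ι R (e i) * x) := by
  refine finsum_eq_sum_of_support_subset _ fun i hi => ?_
  contrapose! hi
  rw [Function.mem_support, not_not, contract_coord_eq_zero hx hi, TensorProduct.zero_tmul]

theorem pluckerTensor_ι_mul (v : M) (x : ExteriorAlgebra R M) :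
    pluckerTensor e (ι R v * x) =
      TensorProduct.map (LinearMap.mulLeft R (ι R v)) (LinearMap.mulLeft R (ι R v))
        (pluckerTensor e x) := by
  classical
  obtain ⟨K, hK⟩ := exists_mem_supported e x
  set J := K ∪ (e.repr v).support
  have hv : (e.repr v).support ⊆ J := Finset.subset_union_right
  have hx : x ∈ supported e J := supported_mono Finset.subset_union_left hK
  have hvv : ι R v * (ι R v * x) = 0 := by
    rw [← mul_assoc, ExteriorAlgebra.ι_sq_zero, zero_mul]
  have hdiag : ∑ i ∈ J, (e.coord i v • x) ⊗ₜ[R] (ι R (e i) * (ι R v * x)) = 0 := by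
    simp_rw [TensorProduct.smul_tmul, ← TensorProduct.tmul_sum, ← smul_mul_assoc, ← map_smul]
    rw [← Finset.sum_mul, ← map_sum, sum_coord_smul_of_support_subset hv, hvv,
      TensorProduct.tmul_zero]
  rw [pluckerTensor_eq_sum (ι_mul_mem_supported hx hv), pluckerTensor_eq_sum hx, map_sum]
  simp_rw [contract_ι_mul, TensorProduct.sub_tmul, Finset.sum_sub_distrib]
  rw [hdiag, zero_sub, ← Finset.sum_neg_distrib]
  refine Finset.sum_congr rfl fun i _ => ?_
  rw [TensorProduct.map_tmul, LinearMap.mulLeft_apply, LinearMap.mulLeft_apply,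
    ← TensorProduct.tmul_neg, ← mul_assoc, ← mul_assoc,
    eq_neg_of_add_eq_zero_left (ExteriorAlgebra.ι_add_mul_swap (e i) v), neg_mul, neg_neg]

theorem pluckerTensor_contract (f : Module.Dual R M) (x : ExteriorAlgebra R M) :
    pluckerTensor e (contract f x) =
      TensorProduct.map (contract f) (contract f) (pluckerTensor e x) := by
  obtain ⟨J, hJ⟩ := exists_mem_supported e x
  have hff : ∑ i ∈ J, f (e i) • contract (e.coord i) (contract f x) = 0 := by
    rw [← mem_supported.1 (contract_mem_supported hJ f), contract_contract]
  rw [pluckerTensor_eq_sum (contract_mem_supported hJ f), pluckerTensor_eq_sum hJ, map_sum,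
    ← sub_eq_zero, ← Finset.sum_sub_distrib]
  have hterm : ∀ i, contract (e.coord i) (contract f x) ⊗ₜ[R] (ι R (e i) * contract f x) -
      TensorProduct.map (contract f) (contract f)
        (contract (e.coord i) x ⊗ₜ[R] (ι R (e i) * x)) =
      (f (e i) • contract (e.coord i) (contract f x)) ⊗ₜ[R] x := fun i => by
    rw [TensorProduct.map_tmul, contract_comm f, TensorProduct.neg_tmul, sub_neg_eq_add,
      ← TensorProduct.tmul_add, contract_ι_mul, add_sub_cancel, TensorProduct.smul_tmul]
  simp_rw [hterm]
  rw [← TensorProduct.sum_tmul, hff, TensorProduct.zero_tmul]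

theorem pluckerTensor_ιMulti {s : ℕ} (v : Fin s → M) : pluckerTensor e (ιMulti R s v) = 0 := by
  induction s with
  | zero =>
    rw [ExteriorAlgebra.ιMulti_zero_apply, pluckerTensor]
    simp_rw [contract_one, TensorProduct.zero_tmul, finsum_zero]
  | succ s ih => rw [ExteriorAlgebra.ιMulti_succ_apply, pluckerTensor_ι_mul, ih, map_zero]

theorem exists_ι_mul_eq_zero (hx : pluckerTensor e x = 0) {f : Module.Dual R M}
    {F : ExteriorAlgebra R M →ₗ[R] R} (hF : F (contract f x) ≠ 0) :
    ∃ w : M, w ≠ 0 ∧ ι R w * x = 0 := by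
  obtain ⟨J, hJ⟩ := exists_mem_supported e x
  refine ⟨∑ i ∈ J, F (contract (e.coord i) x) • e i, fun hw => hF ?_, ?_⟩
  · simpa only [mem_supported.1 hJ f, map_sum, map_smul, map_zero, smul_eq_mul, mul_comm]
      using congrArg f hw
  · have h := congrArg (TensorProduct.lid R _ ∘ TensorProduct.map F LinearMap.id) hx
    simpa only [pluckerTensor_eq_sum hJ, map_zero, map_sum, map_smul, Finset.sum_mul,
      smul_mul_assoc, Function.comp_apply,
      TensorProduct.map_tmul, TensorProduct.lid_tmul, LinearMap.id_apply]
      using h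

section PrincipalIdealDomain

variable [IsDomain R] [IsPrincipalIdealRing R]

theorem exists_smul_unimodular (e : Module.Basis κ R M) {w : M} (hw : w ≠ 0) :
    ∃ (g : R) (v : M) (f : Module.Dual R M), g ≠ 0 ∧ w = g • v ∧ f v = 1 := by
  let I : Ideal R := LinearMap.range (LinearMap.applyₗ (R := R) (M₂ := R) w)
  let g := Submodule.IsPrincipal.generator I
  have hdvd : ∀ i, ∃ a, e.coord i w = g * a := fun i =>
    (Submodule.IsPrincipal.mem_iff_generator_dvd I).1 ⟨e.coord i, rfl⟩
  choose a ha using hdvd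
  let v : M := ∑ i ∈ (e.repr w).support, a i • e i
  have hwv : w = g • v := by
    rw [Finset.smul_sum]
    refine (sum_coord_smul_of_support_subset (e := e) subset_rfl).symm.trans ?_
    exact Finset.sum_congr rfl fun i _ => by rw [ha, mul_smul]
  have hg : g ≠ 0 := fun h0 => hw (by rw [hwv, h0, zero_smul])
  obtain ⟨f, hf⟩ : ∃ f : Module.Dual R M, f w = g := Submodule.IsPrincipal.generator_mem I
  rw [hwv, map_smul, smul_eq_mul] at hf
  exact ⟨g, v, f, hg, hwv, mul_eq_left₀ hg |>.1 hf⟩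

theorem exists_eq_ι_mul_contract {s : ℕ} (hxs : x ∈ ⋀[R]^(s + 1) M) (h0 : x ≠ 0)
    (hx : pluckerTensor e x = 0) :
    ∃ (v : M) (f : Module.Dual R M), x = ι R v * contract f x := by
  classical
  let : LinearOrder κ := linearOrderOfSTO WellOrderingRel
  have : Module.Free R (ExteriorAlgebra R M) := Module.Free.of_basis e.ExteriorAlgebra
  obtain ⟨c, hc⟩ := exists_exteriorForm_coord_ne_zero e hxs h0
  rw [← exteriorForm_contract _ hxs] at hc
  obtain ⟨w, hw, hwx⟩ := exists_ι_mul_eq_zero hx hc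
  obtain ⟨g, v, f, hg, rfl, hfv⟩ := exists_smul_unimodular e hw
  have hvx : ι R v * x = 0 := by
    rw [map_smul, smul_mul_assoc] at hwx
    exact (smul_eq_zero.1 hwx).resolve_left hg
  refine ⟨v, f, ?_⟩
  have h := contract_ι_mul f v x
  rwa [hvx, map_zero, hfv, one_smul, eq_comm, sub_eq_zero] at h

theorem exists_ιMulti_eq_of_pluckerTensor_eq_zero {s : ℕ} (hxs : x ∈ ⋀[R]^(s + 1) M)
    (hx : pluckerTensor e x = 0) : ∃ v : Fin (s + 1) → M, ιMulti R (s + 1) v = x := by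
  induction s generalizing x with
  | zero =>
    rw [ExteriorAlgebra.exteriorPower, zero_add, pow_one] at hxs
    obtain ⟨v, rfl⟩ := hxs
    exact ⟨fun _ => v, by simp [ExteriorAlgebra.ιMulti_succ_apply]⟩
  | succ s ih =>
    rcases eq_or_ne x 0 with rfl | h0
    · exact ⟨0, (ιMulti R (s + 1 + 1)).map_zero⟩
    obtain ⟨v, f, hvf⟩ := exists_eq_ι_mul_contract hxs h0 hx
    obtain ⟨u, hu⟩ := ih (contract_mem hxs f) (by rw [pluckerTensor_contract, hx, map_zero])
    refine ⟨Matrix.vecCons v u, ?_⟩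
    rw [ExteriorAlgebra.ιMulti_succ_apply, Matrix.tail_cons, hu, Matrix.cons_val_zero, ← hvf]

theorem exists_ιMulti_eq_iff_pluckerTensor_eq_zero (e : Module.Basis κ R M) {s : ℕ}
    (hxs : x ∈ ⋀[R]^(s + 1) M) :
    (∃ v : Fin (s + 1) → M, ιMulti R (s + 1) v = x) ↔ pluckerTensor e x = 0 := by
  refine ⟨?_, exists_ιMulti_eq_of_pluckerTensor_eq_zero hxs⟩
  rintro ⟨v, rfl⟩
  exact pluckerTensor_ιMulti v

end PrincipalIdealDomain

end ExteriorAlgebra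

/-! ### Complete symmetric polynomials -/

/-- The basis `(b_i)` of `M₀`; its dual basis is `(bBasis.coord i)`. -/
abbrev bBasis : Module.Basis ℕ ℤ M0 := Polynomial.basisMonomials ℤ

theorem bBasis_apply (i : ℕ) : bBasis i = b i := by
  simp [bBasis, b, Polynomial.X_pow_eq_monomial]

theorem bBasis_coord_b (i j : ℕ) : bBasis.coord i (b j) = if j = i then 1 else 0 := by
  rw [← bBasis_apply, Module.Basis.coord_apply, Module.Basis.repr_self, Finsupp.single_apply]

/-- The coefficients of a power series, as a sequence indexed by `ℤ` which vanishes on negative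
integers. -/
def bilateral {R : Type*} [CommRing R] (S : PowerSeries R) (j : ℤ) : R :=
  if j < 0 then 0 else PowerSeries.coeff j.toNat S

section Bilateral

variable {R : Type*} [CommRing R]

theorem bilateral_natCast (S : PowerSeries R) (j : ℕ) :
    bilateral S (j : ℤ) = PowerSeries.coeff j S := by
  simp [bilateral]

theorem bilateral_of_neg (S : PowerSeries R) {j : ℤ} (hj : j < 0) : bilateral S j = 0 := if_pos hj

theorem bilateral_mul (P S : PowerSeries R) {N : ℕ} {c : ℤ}
    (hN : ∀ l : ℕ, N ≤ l → PowerSeries.coeff l P * bilateral S (c - l) = 0) :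
    bilateral (P * S) c = ∑ l ∈ Finset.range N, PowerSeries.coeff l P * bilateral S (c - l) := by
  rcases lt_or_ge c 0 with hc | hc
  · rw [bilateral_of_neg _ hc, Finset.sum_eq_zero]
    intro l _
    rw [bilateral_of_neg _ (by omega), mul_zero]
  obtain ⟨c, rfl⟩ := Int.eq_ofNat_of_zero_le hc
  have hrange : ∑ l ∈ Finset.range N, PowerSeries.coeff l P * bilateral S ((c : ℤ) - l) =
      ∑ l ∈ Finset.range (c + 1), PowerSeries.coeff l P * bilateral S ((c : ℤ) - l) := by
    trans ∑ l ∈ Finset.range (max N (c + 1)), PowerSeries.coeff l P * bilateral S ((c : ℤ) - l)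
    · exact Finset.sum_subset (Finset.range_mono (le_max_left _ _)) fun l _ hl =>
        hN l (by simpa using hl)
    · refine (Finset.sum_subset (Finset.range_mono (le_max_right _ _)) fun l _ hl => ?_).symm
      rw [Finset.mem_range, not_lt] at hl
      rw [bilateral_of_neg _ (by omega), mul_zero]
  rw [hrange, bilateral_natCast, PowerSeries.coeff_mul,
    Finset.Nat.sum_antidiagonal_eq_sum_range_succ
      (fun i j => PowerSeries.coeff i P * PowerSeries.coeff j S)]
  refine Finset.sum_congr rfl fun l hl => ?_
  rw [← Nat.cast_sub (Finset.mem_range_succ_iff.1 hl), bilateral_natCast]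

theorem map_bilateral {S : Type*} [CommRing S] (f : R →+* S) (P : PowerSeries R) (j : ℤ) :
    f (bilateral P j) = bilateral (PowerSeries.map f P) j := by
  unfold bilateral
  split_ifs
  · exact map_zero f
  · rw [PowerSeries.coeff_map]

theorem coeff_prod_one_sub_C_mul_X {I : Type*} (T : Finset I) (x : I → R) (l : ℕ) :
    PowerSeries.coeff l (∏ k ∈ T, (1 - PowerSeries.C (x k) * PowerSeries.X)) =
      (-1) ^ l * ∑ t ∈ T.powersetCard l, ∏ i ∈ t, x i := by
  have hprod : ∀ t : Finset I, ∏ i ∈ t, -(PowerSeries.C (x i) * PowerSeries.X) =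
      PowerSeries.C ((-1) ^ t.card * ∏ i ∈ t, x i) * PowerSeries.X ^ t.card := fun t => by
    rw [Finset.prod_neg, Finset.prod_mul_distrib, Finset.prod_const, map_mul, map_pow, map_neg,
      map_one, map_prod, mul_assoc]
  simp_rw [sub_eq_add_neg, Finset.prod_one_add, hprod, map_sum, PowerSeries.coeff_C_mul,
    PowerSeries.coeff_X_pow, mul_ite, mul_one, mul_zero]
  rw [← Finset.sum_filter, Finset.mul_sum, Finset.powersetCard_eq_filter]
  refine Finset.sum_congr (Finset.filter_congr fun t _ => eq_comm) fun t ht => ?_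
  rw [(Finset.mem_filter.1 ht).2]

theorem mk_pow_mul_one_sub_C_mul_X (a : R) :
    PowerSeries.mk (fun c => a ^ c) * (1 - PowerSeries.C a * PowerSeries.X) = 1 := by
  simpa [PowerSeries.rescale_mk, PowerSeries.rescale_X] using
    congrArg (PowerSeries.rescale a) (PowerSeries.mk_one_mul_one_sub_eq_one R)

end Bilateral

theorem coeff_zero_E (s : ℕ) : PowerSeries.coeff 0 (E s) = 1 := by
  rw [E, map_add, map_sum, PowerSeries.coeff_zero_one, add_eq_left]
  refine Finset.sum_eq_zero fun i _ => ?_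
  rw [PowerSeries.coeff_monomial, if_neg i.val.succ_ne_zero.symm]

theorem coeff_succ_E {s : ℕ} (i : Fin s) :
    PowerSeries.coeff (i + 1) (E s) = (-1) ^ (i + 1 : ℕ) * MvPolynomial.X i := by
  simp [E, PowerSeries.coeff_monomial, PowerSeries.coeff_one, Fin.val_inj]

theorem coeff_E_of_lt {s l : ℕ} (hl : s < l) : PowerSeries.coeff l (E s) = 0 := by
  rw [E, map_add, map_sum, PowerSeries.coeff_one, if_neg (by omega), zero_add]
  refine Finset.sum_eq_zero fun i _ => ?_
  rw [PowerSeries.coeff_monomial, if_neg (by omega)]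

theorem h_of_neg {s : ℕ} {j : ℤ} (hj : j < 0) : h s j = 0 := if_pos hj

theorem h_zero (s : ℕ) : h s 0 = 1 := by
  have := congrArg (PowerSeries.coeff 0) (E_mul_invE s)
  rw [PowerSeries.coeff_mul] at this
  simpa [h, coeff_zero_E] using this

theorem hRow_b (s c : ℕ) : hRow s (b c) = fun l : Fin s => h s ((c : ℤ) - (l : ℤ)) := by
  rw [← bBasis_apply, hRow, Module.Basis.constr_basis]

theorem phiInv_ιMulti {s : ℕ} (v : Fin s → M0) :
    phiInv s (ExteriorAlgebra.ιMulti ℤ s v) = Matrix.det (Matrix.of fun k => hRow s (v k)) := by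
  rw [phiInv, ExteriorAlgebra.liftAlternating_apply_ιMulti, Pi.single_eq_same]
  rfl

theorem phiInv_ιMulti_b {s : ℕ} (c : Fin s → ℕ) :
    phiInv s (ExteriorAlgebra.ιMulti ℤ s fun k => b (c k)) =
      Matrix.det (Matrix.of fun k l : Fin s => h s ((c k : ℤ) - (l : ℤ))) := by
  simp_rw [phiInv_ιMulti, hRow_b]

/-! ### The bialternant formula and the injectivity of `φ_s⁻¹` -/

/-- The identification of `B_s` with the ring of symmetric polynomials in `x_1, …, x_s`: it maps
`e_i` to the `i`-th elementary symmetric polynomial. -/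
def symmEval (s : ℕ) : B s →+* MvPolynomial (Fin s) ℤ :=
  (MvPolynomial.aeval fun i : Fin s => MvPolynomial.esymm (Fin s) ℤ (i + 1)).toRingHom

theorem map_symmEval_E (s : ℕ) : PowerSeries.map (symmEval s) (E s) =
    ∏ i : Fin s, (1 - PowerSeries.C (MvPolynomial.X i) * PowerSeries.X) := by
  ext1 l
  rw [PowerSeries.coeff_map, coeff_prod_one_sub_C_mul_X]
  rcases l with _ | l
  · simp [coeff_zero_E]
  rcases lt_or_ge l s with hl | hl
  · rw [coeff_succ_E ⟨l, hl⟩]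
    simp [symmEval, MvPolynomial.esymm]
  · rw [coeff_E_of_lt (by omega), map_zero,
      Finset.powersetCard_eq_empty.2 (by rw [Finset.card_fin]; omega), Finset.sum_empty, mul_zero]

/-- The matrix whose column `i` consists of the coefficients of `∏_{k ≠ i} (1 - x_k z)`; its
determinant is the Vandermonde determinant up to sign. -/
def omitCoeff (s : ℕ) : Matrix (Fin s) (Fin s) (MvPolynomial (Fin s) ℤ) :=
  Matrix.of fun l i => PowerSeries.coeff (l : ℕ)
    (∏ k ∈ Finset.univ.erase i, (1 - PowerSeries.C (MvPolynomial.X k) * PowerSeries.X))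

theorem prod_erase_mul_map_symmEval_invE {s : ℕ} (i : Fin s) :
    (∏ k ∈ Finset.univ.erase i, (1 - PowerSeries.C (MvPolynomial.X k) * PowerSeries.X)) *
      PowerSeries.map (symmEval s) (invE s) = PowerSeries.mk fun c => MvPolynomial.X i ^ c := by
  have hE := congrArg (PowerSeries.map (symmEval s)) (E_mul_invE s)
  rw [map_mul, map_one, map_symmEval_E, ← Finset.mul_prod_erase _ _ (Finset.mem_univ i),
    mul_assoc] at hE
  exact (left_inv_eq_right_inv (mk_pow_mul_one_sub_C_mul_X _) hE).symm

theorem sum_symmEval_hRow_mul_omitCoeff {s : ℕ} (v : M0) (i : Fin s) :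
    ∑ l, symmEval s (hRow s v l) * omitCoeff s l i = Polynomial.aeval (MvPolynomial.X i) v := by
  let F : M0 →ₗ[ℤ] MvPolynomial (Fin s) ℤ := ∑ l, LinearMap.mulRight ℤ (omitCoeff s l i) ∘ₗ
    (symmEval s).toIntAlgHom.toLinearMap ∘ₗ LinearMap.proj l ∘ₗ hRow s
  have hF : ∀ u, F u = ∑ l, symmEval s (hRow s u l) * omitCoeff s l i := fun u => by simp [F]
  suffices F = (Polynomial.aeval (MvPolynomial.X i)).toLinearMap by
    rw [← hF, this, AlgHom.toLinearMap_apply]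
  refine bBasis.ext fun c => ?_
  have hc := bilateral_mul (N := s) (c := (c : ℤ)) (∏ k ∈ Finset.univ.erase i,
    (1 - PowerSeries.C (MvPolynomial.X k) * PowerSeries.X)) (PowerSeries.map (symmEval s) (invE s))
    fun l hl => by
      rw [coeff_prod_one_sub_C_mul_X, Finset.powersetCard_eq_empty.2, Finset.sum_empty, mul_zero,
        zero_mul]
      rw [Finset.card_erase_of_mem (Finset.mem_univ i), Finset.card_fin]
      exact (Nat.sub_lt i.pos one_pos).trans_le hl
  rw [prod_erase_mul_map_symmEval_invE, bilateral_natCast, PowerSeries.coeff_mk,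
    Finset.sum_range] at hc
  rw [hF, bBasis_apply, AlgHom.toLinearMap_apply, b, map_pow (Polynomial.aeval _),
    Polynomial.aeval_X, hc]
  refine Finset.sum_congr rfl fun l _ => ?_
  rw [mul_comm, ← b, hRow_b, ← map_bilateral]
  rfl

theorem symmEval_phiInv_mul_det {s : ℕ} (v : Fin s → M0) :
    symmEval s (phiInv s (ExteriorAlgebra.ιMulti ℤ s v)) * (omitCoeff s).det =
      Matrix.det (Matrix.of fun k i => Polynomial.aeval (MvPolynomial.X (R := ℤ) i) (v k)) := by
  rw [phiInv_ιMulti, RingHom.map_det, ← Matrix.det_mul]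
  congr 1
  ext1 k i
  rw [Matrix.mul_apply, Matrix.of_apply, ← sum_symmEval_hRow_mul_omitCoeff]
  rfl

theorem symmEval_phiInv_b_mul_det {s : ℕ} (c : Fin s → ℕ) :
    symmEval s (phiInv s (ExteriorAlgebra.ιMulti ℤ s fun k => b (c k))) * (omitCoeff s).det =
      ∑ σ : Equiv.Perm (Fin s), Equiv.Perm.sign σ •
        MvPolynomial.monomial (Finsupp.equivFunOnFinite.symm fun i => c (σ i)) (1 : ℤ) := by
  rw [symmEval_phiInv_mul_det, Matrix.det_apply]
  refine Finset.sum_congr rfl fun σ _ => ?_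
  rw [MvPolynomial.monomial_eq, map_one, one_mul, Finsupp.prod_fintype _ _ fun i => pow_zero _]
  simp [b]

/-- The linear form on `B_s` which gives the coordinate of `φ_s(p)` along
`b_{c_1} ∧ ⋯ ∧ b_{c_s}`, see `coordB_phiInv`. By the bialternant formula, it is a coefficient of
the product of `p` and the Vandermonde determinant. -/
def coordB (s : ℕ) (c : Fin s → ℕ) : B s →ₗ[ℤ] ℤ :=
  MvPolynomial.lcoeff ℤ (Finsupp.equivFunOnFinite.symm c) ∘ₗ
    LinearMap.mulRight ℤ (omitCoeff s).det ∘ₗ (symmEval s).toIntAlgHom.toLinearMap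

theorem coordB_apply {s : ℕ} (c : Fin s → ℕ) (p : B s) : coordB s c p =
    MvPolynomial.coeff (Finsupp.equivFunOnFinite.symm c) (symmEval s p * (omitCoeff s).det) :=
  rfl

theorem coordB_phiInv {s : ℕ} (c : Fin s → ℕ) {x : Ext} (hx : x ∈ ⋀[ℤ]^s M0) :
    coordB s c (phiInv s x) = exteriorForm (fun k => bBasis.coord (c k)) x := by
  refine linearMap_eqOn_exteriorPower_of_basis bBasis (F := coordB s c ∘ₗ phiInv s)
    (fun d => ?_) hx
  simp_rw [bBasis_apply]
  rw [LinearMap.comp_apply, coordB_apply, symmEval_phiInv_b_mul_det, exteriorForm_ιMulti,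
    Matrix.det_apply, MvPolynomial.coeff_sum]
  refine Finset.sum_congr rfl fun σ _ => ?_
  rw [MvPolynomial.coeff_smul, MvPolynomial.coeff_monomial]
  simp only [Matrix.of_apply, bBasis_coord_b, Finset.prod_ite_zero, Finset.prod_const_one,
    EmbeddingLike.apply_eq_iff_eq, funext_iff, Finset.mem_univ, true_implies]

theorem phiInv_injective (s : ℕ) :
    Function.Injective fun m : ⋀[ℤ]^s M0 => phiInv s (m : Ext) := by
  intro x y hxy
  have hmem := Submodule.sub_mem _ x.2 y.2
  apply Subtype.ext
  rw [← sub_eq_zero]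
  by_contra hne
  obtain ⟨c, hc⟩ := exists_exteriorForm_coord_ne_zero bBasis hmem hne
  rw [← coordB_phiInv c hmem, map_sub, sub_eq_zero.2 hxy, map_zero] at hc
  exact hc rfl

theorem phi_phiInv {s : ℕ} (m : ⋀[ℤ]^s M0) : phi s (phiInv s (m : Ext)) = m :=
  Function.leftInverse_invFun (phiInv_injective s) m

/-! ### The truncated rings -/

/-- The partition `(j, 0, …, 0)`. -/
def rowPartition (s j : ℕ) : Fin (s + 1) → ℕ := fun i => if i = 0 then j else 0

theorem schurDet_rowPartition {R : Type*} [CommRing R] (s j : ℕ) {g : ℤ → R} (h0 : g 0 = 1)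
    (hneg : ∀ i < 0, g i = 0) : schurDet (rowPartition s j) g = g j := by
  rw [schurDet, Matrix.det_of_isLowerTriangular, Fin.prod_univ_succ, Finset.prod_eq_one]
  · simp [rowPartition]
  · intro i _
    simp [rowPartition, Fin.succ_ne_zero, h0]
  · intro i k (hik : i < k)
    have hk : k ≠ 0 := (lt_of_le_of_lt (Fin.zero_le i) hik).ne'
    rw [Matrix.of_apply, rowPartition, if_neg hk]
    apply hneg
    rw [Fin.lt_def] at hik
    push_cast
    omega

theorem phiInv_wedge_rowPartition (s j : ℕ) :
    phiInv (s + 1) (wedge (rowPartition s j) : Ext) = h (s + 1) j := by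
  rw [phiInv_wedge, schurDet_rowPartition s j (h_zero _) fun _ => h_of_neg]

theorem coordB_mul_h {s n : ℕ} {c : Fin s → ℕ} (hc : ∀ i, c i < n) (q : B s) {j : ℤ}
    (hj : (n : ℤ) - s + 1 ≤ j) (hj' : j ≤ n) : coordB s c (q * h s j) = 0 := by
  rcases lt_or_ge j 0 with hj0 | hj0
  · rw [h_of_neg hj0, mul_zero, map_zero]
  obtain ⟨j, rfl⟩ := Int.eq_ofNat_of_zero_le hj0
  rcases s with _ | s
  · omega
  rw [← phiInv_wedge_rowPartition, coordB_apply, map_mul, mul_assoc, wedge,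
    exteriorPower.ιMulti_apply_coe,
    symmEval_phiInv_b_mul_det (fun k : Fin (s + 1) => k + rowPartition s j k.rev), Finset.mul_sum,
    MvPolynomial.coeff_sum]
  refine Finset.sum_eq_zero fun σ _ => ?_
  rw [mul_smul_comm, MvPolynomial.coeff_smul, MvPolynomial.coeff_mul_monomial', if_neg, smul_zero]
  -- Each term of the alternating sum has a variable of exponent `s + j`, and `n ≤ s + j`.
  intro hle
  have hlast : s + j ≤ c (σ.symm (Fin.last s)) := by
    simpa [rowPartition] using hle (σ.symm (Fin.last s))
  have := hc (σ.symm (Fin.last s))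
  omega

theorem coordB_eq_zero_of_mem_truncIdeal {s n : ℕ} {c : Fin s → ℕ} (hc : ∀ i, c i < n) {p : B s}
    (hp : p ∈ truncIdeal s n) : coordB s c p = 0 := by
  suffices ∀ q, coordB s c (q * p) = 0 by simpa using this 1
  rw [truncIdeal] at hp
  induction hp using Submodule.span_induction with
  | mem p hp =>
    obtain ⟨j, ⟨hj, hj'⟩, rfl⟩ := hp
    exact fun q => coordB_mul_h hc q hj hj'
  | zero => exact fun q => by rw [mul_zero, map_zero]
  | add p p' _ _ hp hp' => exact fun q => by rw [mul_add, map_add, hp, hp', add_zero]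
  | smul a p _ hp => exact fun q => by rw [smul_eq_mul, ← mul_assoc, hp]

open Classical in
/-- The linear map `B_{s,n} → ⋀ˢ M₀` which sends the class of `p` to the part of `φ_s(p)`
supported on `b_0, …, b_{n-1}`, see `truncPhi_proj_phiInv`. -/
def truncPhi (s n : ℕ) : BT s n →ₗ[ℤ] Ext :=
  ((truncIdeal s n).restrictScalars ℤ).liftQ
    (∑ t ∈ ((Finset.range n).powersetCard s).subtype (· ∈ Set.powersetCard ℕ s),
      (coordB s (Set.powersetCard.ofFinEmbEquiv.symm t)).smulRight
        (ExteriorAlgebra.ιMulti ℤ s fun k => bBasis (Set.powersetCard.ofFinEmbEquiv.symm t k)))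
    fun p hp => by
      rw [LinearMap.mem_ker, LinearMap.sum_apply]
      refine Finset.sum_eq_zero fun t ht => ?_
      rw [LinearMap.smulRight_apply, coordB_eq_zero_of_mem_truncIdeal (fun k => ?_) hp, zero_smul]
      rw [Finset.mem_subtype, Finset.mem_powersetCard] at ht
      exact Finset.mem_range.1 <| ht.1 <|
        (Set.powersetCard.mem_range_ofFinEmbEquiv_symm_iff_mem t _).1 ⟨k, rfl⟩

theorem truncPhi_proj_phiInv {s n : ℕ} {x : Ext} (hxs : x ∈ ⋀[ℤ]^s M0)
    (hx : x ∈ supported bBasis (Finset.range n)) : truncPhi s n (proj s n (phiInv s x)) = x := by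
  classical
  conv_rhs => rw [← sum_exteriorForm_smul_ιMulti hxs hx]
  simp_rw [← coordB_phiInv _ hxs]
  exact LinearMap.sum_apply _ _ _

/-- The polarized Plücker tensor `∑_i φ_s⁻¹(β_i ⌟ x) ⊗ φ_{s+2}⁻¹(b_i ∧ y)`, reduced to
`B_{s,n} ⊗ B_{s+2,n}`, with `β_i` the form dual to `b_i`. -/
def pluckerForm (s n : ℕ) (x y : Ext) : BT s n ⊗[ℤ] BT (s + 2) n :=
  ∑ i ∈ Finset.range n, proj s n (phiInv s (contract (bBasis.coord i) x)) ⊗ₜ[ℤ]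
    proj (s + 2) n (phiInv (s + 2) (ExteriorAlgebra.ι ℤ (b i) * y))

theorem pluckerTensor_eq_zero_iff_pluckerForm {s n : ℕ} {x : Ext} (hxs : x ∈ ⋀[ℤ]^(s + 1) M0)
    (hx : x ∈ supported bBasis (Finset.range n)) :
    pluckerTensor bBasis x = 0 ↔ pluckerForm s n x x = 0 := by
  rw [pluckerTensor_eq_sum hx, pluckerForm]
  simp_rw [bBasis_apply]
  constructor <;> intro h0
  · have h1 := congrArg (TensorProduct.map
      ((proj s n).toIntAlgHom.toLinearMap ∘ₗ phiInv s)
      ((proj (s + 2) n).toIntAlgHom.toLinearMap ∘ₗ phiInv (s + 2))) h0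
    rwa [map_sum, map_zero] at h1
  · have h1 := congrArg (TensorProduct.map (truncPhi s n) (truncPhi (s + 2) n)) h0
    rw [map_sum, map_zero] at h1
    rw [← h1]
    refine Finset.sum_congr rfl fun i hi => ?_
    have hb : (bBasis.repr (b i)).support ⊆ Finset.range n := by
      rw [← bBasis_apply, Module.Basis.repr_self]
      exact Finsupp.support_single_subset.trans (Finset.singleton_subset_iff.2 hi)
    rw [TensorProduct.map_tmul, truncPhi_proj_phiInv (contract_mem hxs _)
      (contract_mem_supported hx _), truncPhi_proj_phiInv (ι_mul_mem hxs _)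
      (ι_mul_mem_supported hx hb)]

/-! ### The Schubert derivations on `B_s` -/

theorem schurDet_eq_det {R : Type*} [CommRing R] {s : ℕ} (lam : Fin s → ℕ) (g : ℤ → R) :
    schurDet lam g =
      Matrix.det (Matrix.of fun k l : Fin s => g (((k + lam k.rev : ℕ) : ℤ) - (l : ℤ))) := by
  rw [schurDet, ← Matrix.det_transpose, ← Matrix.det_submatrix_equiv_self (Fin.revPerm (n := s))]
  congr 1
  ext1 k l
  simp only [Matrix.submatrix_apply, Matrix.transpose_apply, Matrix.of_apply, Fin.revPerm_apply]
  refine congrArg g ?_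
  rw [Fin.val_rev, Fin.val_rev]
  omega

theorem map_schurDet {R S : Type*} [CommRing R] [CommRing S] (f : R →+* S) {s : ℕ}
    (lam : Fin s → ℕ) (g : ℤ → R) : f (schurDet lam g) = schurDet lam fun j => f (g j) := by
  rw [schurDet, RingHom.map_det]
  rfl

/-- The map `φ_s⁻¹` applied to the coefficients of a polynomial. -/
def polyPhiInv (s : ℕ) : Polynomial Ext →ₗ[ℤ] Polynomial (B s) where
  toFun P := P.sum fun i m => Polynomial.monomial i (phiInv s m)
  map_add' P Q := Polynomial.sum_add_index _ _ _ (by simp) (by simp)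
  map_smul' a P := by
    rw [Polynomial.sum_smul_index' _ _ _ (by simp), Polynomial.sum_def, Polynomial.sum_def,
      RingHom.id_apply, Finset.smul_sum]
    simp only [map_smul, Polynomial.smul_monomial]

theorem polyPhiInv_monomial (s i : ℕ) (x : Ext) :
    polyPhiInv s (Polynomial.monomial i x) = Polynomial.monomial i (phiInv s x) :=
  Polynomial.sum_monomial_index x (fun i m => Polynomial.monomial i (phiInv s m)) (by simp)

/-- The inclusion of `M₀[w]` in `(⋀ M₀)[w]`; elements of `M₀[w]` are encoded by their finitely
supported families of coefficients. -/
def polyι : (ℕ →₀ M0) →ₗ[ℤ] Polynomial Ext :=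
  Finsupp.lsum ℤ fun i =>
    (Polynomial.monomial i : Ext →ₗ[Ext] Polynomial Ext).restrictScalars ℤ ∘ₗ ExteriorAlgebra.ι ℤ

theorem polyι_single (i : ℕ) (v : M0) :
    polyι (Finsupp.single i v) = Polynomial.monomial i (ExteriorAlgebra.ι ℤ v) := by
  simp [polyι]

/-- The extension of `hRow` to `M₀[w]`. -/
def polyHRow (s : ℕ) : (ℕ →₀ M0) →ₗ[ℤ] (Fin s → Polynomial (B s)) :=
  Finsupp.lsum ℤ fun i => LinearMap.pi fun l =>
    (Polynomial.monomial i : B s →ₗ[B s] Polynomial (B s)).restrictScalars ℤ ∘ₗ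
      LinearMap.proj l ∘ₗ hRow s

theorem polyHRow_single (s i : ℕ) (v : M0) (l : Fin s) :
    polyHRow s (Finsupp.single i v) l = Polynomial.monomial i (hRow s v l) := by
  simp [polyHRow]

theorem prod_ofFn_monomial {R : Type*} [Semiring R] {s : ℕ} (i : Fin s → ℕ) (u : Fin s → R) :
    (List.ofFn fun k => Polynomial.monomial (i k) (u k)).prod =
      Polynomial.monomial (∑ k, i k) (List.ofFn u).prod := by
  induction s with
  | zero => simp
  | succ s ih =>
    rw [List.ofFn_succ, List.prod_cons, ih, Polynomial.monomial_mul_monomial, List.ofFn_succ,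
      List.prod_cons, Fin.sum_univ_succ]

theorem polyPhiInv_prod_monomial {s : ℕ} (i : Fin s → ℕ) (v : Fin s → M0) :
    polyPhiInv s (List.ofFn fun k => Polynomial.monomial (i k) (ExteriorAlgebra.ι ℤ (v k))).prod =
      Matrix.det (Matrix.of fun k l => Polynomial.monomial (i k) (hRow s (v k) l)) := by
  rw [prod_ofFn_monomial, polyPhiInv_monomial, ← ExteriorAlgebra.ιMulti_apply, phiInv_ιMulti]
  have hM : (Matrix.of fun k l => Polynomial.monomial (i k) (hRow s (v k) l)) =
      Matrix.of fun k l => (Polynomial.X : Polynomial (B s)) ^ i k *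
        (Polynomial.C.mapMatrix (Matrix.of fun k => hRow s (v k))) k l := by
    ext1 k l
    rw [Matrix.of_apply, Matrix.of_apply, RingHom.mapMatrix_apply, Matrix.map_apply,
      Matrix.of_apply, mul_comm, Polynomial.C_mul_X_pow_eq_monomial]
  rw [hM, Matrix.det_mul_column, ← RingHom.map_det, Finset.prod_pow_eq_pow_sum, mul_comm,
    Polynomial.C_mul_X_pow_eq_monomial]

theorem polyPhiInv_prod {s : ℕ} (q : Fin s → ℕ →₀ M0) :
    polyPhiInv s (List.ofFn fun k => polyι (q k)).prod =
      Matrix.det (Matrix.of fun k => polyHRow s (q k)) := by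
  let F : MultilinearMap ℤ (fun _ : Fin s => ℕ →₀ M0) (Polynomial (B s)) :=
    (polyPhiInv s).compMultilinearMap
      ((MultilinearMap.mkPiAlgebraFin ℤ s (Polynomial Ext)).compLinearMap fun _ => polyι)
  let G : MultilinearMap ℤ (fun _ : Fin s => ℕ →₀ M0) (Polynomial (B s)) :=
    ((Matrix.detRowAlternating (n := Fin s)
      (R := Polynomial (B s))).toMultilinearMap.restrictScalars ℤ).compLinearMap
        fun _ => polyHRow s
  suffices F = G from Eq.trans (by simp [F]) (congrArg (fun A => A q) this)
  refine Module.Basis.ext_multilinear (fun _ => Finsupp.basis fun _ : ℕ => bBasis) fun t => ?_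
  simp_rw [Finsupp.coe_basis]
  change polyPhiInv s (List.ofFn fun k => polyι (Finsupp.single (t k).1 (bBasis (t k).2))).prod =
    Matrix.det (Matrix.of fun k l => polyHRow s (Finsupp.single (t k).1 (bBasis (t k).2)) l)
  simp_rw [polyι_single, polyHRow_single]
  exact polyPhiInv_prod_monomial _ _

theorem hsDerivation_ιMulti_b (f : ℕ → Polynomial Ext) (hf : ∀ j, f j ∈ degOne) {s : ℕ}
    (c : Fin s → ℕ) : hsDerivation f hf (ExteriorAlgebra.ιMulti ℤ s fun k => b (c k)) =
      (List.ofFn fun k => f (c k)).prod := by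
  rw [ExteriorAlgebra.ιMulti_apply, map_list_prod, List.map_ofFn]
  congr 2
  ext1 k
  rw [Function.comp_apply, hsDerivation, ExteriorAlgebra.lift_ι_apply, genMap, ← bBasis_apply,
    Module.Basis.constr_basis]

theorem transport_schurDet {s : ℕ} {f : ℕ → Polynomial Ext} (hf : ∀ j, f j ∈ degOne)
    (q : ℕ → ℕ →₀ M0) (hq : ∀ j, polyι (q j) = f j) {g : ℤ → Polynomial (B s)}
    (hg : ∀ (j : ℕ) (l : Fin s), polyHRow s (q j) l = g ((j : ℤ) - l)) (lam : Fin s → ℕ) :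
    transport s (hsDerivation f hf) (schurDet lam (h s)) = schurDet lam g := by
  have hpoly : transport s (hsDerivation f hf) (schurDet lam (h s)) =
      polyPhiInv s (hsDerivation f hf (wedge lam : Ext)) := by
    rw [← phiInv_wedge, transport, phi_phiInv]
    rfl
  rw [hpoly, wedge, exteriorPower.ιMulti_apply_coe,
    hsDerivation_ιMulti_b f hf (fun k : Fin s => k + lam k.rev)]
  simp_rw [← hq]
  rw [polyPhiInv_prod, schurDet_eq_det]
  congr 1
  ext1 k l
  exact hg _ _

theorem transport_zero (s : ℕ) (D : Ext →ₐ[ℤ] Polynomial Ext) : transport s D 0 = 0 := by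
  have hphi : phi s 0 = 0 := by
    have := phi_phiInv (0 : ⋀[ℤ]^s M0)
    rwa [Submodule.coe_zero, map_zero] at this
  rw [transport, hphi, Submodule.coe_zero, map_zero, Polynomial.sum_zero_index]

/-- The sequence `(∑_{i ≥ 0} h_{j-i} z⁻ⁱ)_j`, which is `σ₋(z) H_s`, see `sigmaMinusH_eq`. In terms
of power series in an auxiliary variable `w`, it is given by `1 / ((1 - z⁻¹ w) E_s(w))`. -/
def sigmaSeq (s : ℕ) (j : ℤ) : Polynomial (B s) :=
  bilateral ((PowerSeries.mk fun i => (Polynomial.X : Polynomial (B s)) ^ i) *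
    PowerSeries.map Polynomial.C (invE s)) j

/-- The sequence `(h_j - h_{j-1} z⁻¹)_j`, which is `σ̄₋(z) H_s` for `s ≥ 1`, see
`sigmaBarMinusH_eq`. -/
def sigmaBarSeq (s : ℕ) (j : ℤ) : Polynomial (B s) :=
  Polynomial.C (h s j) - Polynomial.X * Polynomial.C (h s (j - 1))

theorem sigmaSeq_of_neg {s : ℕ} {j : ℤ} (hj : j < 0) : sigmaSeq s j = 0 := bilateral_of_neg _ hj

theorem sigmaBarSeq_of_neg {s : ℕ} {j : ℤ} (hj : j < 0) : sigmaBarSeq s j = 0 := by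
  rw [sigmaBarSeq, h_of_neg hj, h_of_neg (by omega), map_zero, mul_zero, sub_zero]

theorem sigmaSeq_eq_sum {s : ℕ} {j : ℤ} {N : ℕ} (hN : j < N) :
    sigmaSeq s j = ∑ i ∈ Finset.range N, Polynomial.monomial i (h s (j - i)) := by
  rw [sigmaSeq, bilateral_mul (N := N)]
  · refine Finset.sum_congr rfl fun i _ => ?_
    rw [PowerSeries.coeff_mk, ← map_bilateral, mul_comm, Polynomial.C_mul_X_pow_eq_monomial]
    rfl
  · intro l hl
    rw [bilateral_of_neg _ (by omega), mul_zero]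

theorem sigmaSeq_zero (s : ℕ) : sigmaSeq s 0 = 1 := by
  rw [sigmaSeq_eq_sum (N := 1) one_pos]
  simp [h_zero]

theorem sigmaBarSeq_zero (s : ℕ) : sigmaBarSeq s 0 = 1 := by
  rw [sigmaBarSeq, h_zero, h_of_neg (by norm_num), map_one, map_zero, mul_zero, sub_zero]

theorem sigmaMinusB_schurDet {s : ℕ} (lam : Fin s → ℕ) :
    sigmaMinusB s (schurDet lam (h s)) = schurDet lam (sigmaSeq s) := by
  refine transport_schurDet sigmaGen_mem
    (fun j => ∑ i ∈ Finset.range (j + 1), Finsupp.single i (b (j - i)))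
    (fun j => ?_) (fun j l => ?_) lam
  · simp_rw [map_sum, polyι_single]
    rfl
  · rw [map_sum, Finset.sum_apply, sigmaSeq_eq_sum (N := j + 1) (by omega)]
    refine Finset.sum_congr rfl fun i hi => ?_
    rw [polyHRow_single, hRow_b, Nat.cast_sub (Finset.mem_range_succ_iff.1 hi), sub_right_comm]

theorem sigmaBarMinusB_schurDet {s : ℕ} (lam : Fin s → ℕ) :
    sigmaBarMinusB s (schurDet lam (h s)) = schurDet lam (sigmaBarSeq s) := by
  refine transport_schurDet sigmaBarGen_mem
    (fun j => Finsupp.single 0 (b j) - if j = 0 then 0 else Finsupp.single 1 (b (j - 1)))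
    (fun j => ?_) (fun j l => ?_) lam
  · rw [map_sub, polyι_single, sigmaBarGen]
    split_ifs
    · rw [map_zero]
    · rw [polyι_single]
  · rw [map_sub, Pi.sub_apply, polyHRow_single, hRow_b, sigmaBarSeq, Polynomial.monomial_zero_left]
    rcases j with _ | j
    · rw [if_pos rfl, map_zero, Pi.zero_apply, h_of_neg (j := _ - 1) (by omega), map_zero, mul_zero]
    · rw [if_neg j.succ_ne_zero, polyHRow_single, hRow_b, mul_comm,
        Polynomial.C_mul_X_eq_monomial, Nat.add_sub_cancel, sub_right_comm, Nat.cast_succ,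
        add_sub_cancel_right]

theorem invE_zero : invE 0 = 1 := by
  have := E_mul_invE 0
  rwa [E, Finset.univ_eq_empty, Finset.sum_empty, add_zero, one_mul] at this

theorem sigmaMinusH_eq (s : ℕ) (j : ℤ) : sigmaMinusH s j = sigmaSeq s j := by
  cases s with
  | zero =>
    rw [sigmaMinusH, if_pos rfl, sigmaSeq, invE_zero, map_one, mul_one, bilateral,
      PowerSeries.coeff_mk]
  | succ s =>
    rw [sigmaMinusH, if_neg s.succ_ne_zero]
    rcases lt_or_ge j 0 with hj | hj
    · rw [h_of_neg hj, sigmaSeq_of_neg hj, sigmaMinusB, transport_zero]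
    · obtain ⟨j, rfl⟩ := Int.eq_ofNat_of_zero_le hj
      rw [← phiInv_wedge_rowPartition, phiInv_wedge, sigmaMinusB_schurDet,
        schurDet_rowPartition s j (sigmaSeq_zero _) fun _ => sigmaSeq_of_neg]

theorem sigmaBarMinusH_eq (s : ℕ) (j : ℤ) :
    sigmaBarMinusH (s + 1) j = sigmaBarSeq (s + 1) j := by
  rw [sigmaBarMinusH]
  rcases lt_or_ge j 0 with hj | hj
  · rw [h_of_neg hj, sigmaBarSeq_of_neg hj, sigmaBarMinusB, transport_zero]
  · obtain ⟨j, rfl⟩ := Int.eq_ofNat_of_zero_le hj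
    rw [← phiInv_wedge_rowPartition, phiInv_wedge, sigmaBarMinusB_schurDet,
      schurDet_rowPartition s j (sigmaBarSeq_zero _) fun _ => sigmaBarSeq_of_neg]

/-! ### Determinantal identities -/

section Determinants

variable {R : Type*} [CommRing R]

theorem bilateral_geom_mul (y : R) (S : PowerSeries R) (j : ℤ) :
    bilateral (PowerSeries.mk (fun i => y ^ i) * S) j =
      bilateral S j + y * bilateral (PowerSeries.mk (fun i => y ^ i) * S) (j - 1) := by
  set G := PowerSeries.mk (fun i => y ^ i) * S
  have hS : S = (1 - PowerSeries.C y * PowerSeries.X) * G := by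
    rw [← mul_assoc, mul_comm _ (PowerSeries.mk _), mk_pow_mul_one_sub_C_mul_X, one_mul]
  have hrec : bilateral S j = bilateral G j - y * bilateral G (j - 1) := by
    conv_lhs => rw [hS]
    rw [bilateral_mul (N := 2) (1 - PowerSeries.C y * PowerSeries.X) G, Finset.sum_range_succ,
      Finset.sum_range_one]
    · simp [mul_comm _ (PowerSeries.X : PowerSeries R), PowerSeries.coeff_one, sub_eq_add_neg]
    · intro l hl
      rw [map_sub, PowerSeries.coeff_one, if_neg (by omega), PowerSeries.coeff_C_mul,
        PowerSeries.coeff_X, if_neg (by omega), mul_zero, sub_zero, zero_mul]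
  rw [hrec, sub_add_cancel]

theorem det_geom_mul_eq_det_updateCol {s : ℕ} (S : PowerSeries R) (y : R) (c : Fin (s + 1) → ℕ) :
    Matrix.det (Matrix.of fun k l : Fin (s + 1) =>
      bilateral (PowerSeries.mk (fun i => y ^ i) * S) ((c k : ℤ) - (l : ℤ))) =
    Matrix.det ((Matrix.of fun k l : Fin (s + 1) => bilateral S ((c k : ℤ) - (l : ℤ))).updateCol
      (Fin.last s) fun k => bilateral (PowerSeries.mk (fun i => y ^ i) * S) ((c k : ℤ) - s)) := by
  rw [← Matrix.det_submatrix_equiv_self (Fin.revPerm (n := s + 1)),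
    ← Matrix.det_submatrix_equiv_self (Fin.revPerm (n := s + 1)) (Matrix.updateCol _ _ _)]
  refine Matrix.det_eq_of_forall_col_eq_smul_add_pred (fun _ => y) (fun k => ?_) fun k j => ?_
  · simp
  · simp only [Matrix.submatrix_apply, Fin.revPerm_apply, Fin.rev_succ, Fin.rev_castSucc,
      Matrix.of_apply]
    rw [Matrix.updateCol_ne (Fin.castSucc_lt_last _).ne, bilateral_geom_mul, Matrix.of_apply,
      Fin.val_castSucc, Fin.val_succ, Nat.cast_succ, sub_sub]

theorem sum_mul_det_geom_mul {s : ℕ} {P S : PowerSeries R} (hPS : P * S = 1)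
    (hP : ∀ l, s < l → PowerSeries.coeff l P = 0) (y : R) (c : Fin (s + 1) → ℕ) :
    (∑ l ∈ Finset.range (s + 1), PowerSeries.coeff l P * y ^ (s - l)) *
      Matrix.det (Matrix.of fun k l : Fin (s + 1) =>
        bilateral (PowerSeries.mk (fun i => y ^ i) * S) ((c k : ℤ) - (l : ℤ))) =
    Matrix.det ((Matrix.of fun k l : Fin (s + 1) =>
      bilateral S ((c k : ℤ) - (l : ℤ))).updateCol (Fin.last s) fun k => y ^ c k) := by
  set G := PowerSeries.mk (fun i => y ^ i) * S with hG
  let A : Matrix (Fin (s + 1)) (Fin (s + 1)) R :=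
    Matrix.of fun k l => bilateral S ((c k : ℤ) - (l : ℤ))
  let D : (Fin (s + 1) → R) →ₗ[R] R := LinearMap.proj (Fin.last s) ∘ₗ Matrix.cramer A
  let col (l : ℕ) (k : Fin (s + 1)) : R := bilateral G ((c k : ℤ) - l)
  -- `D` kills the first `s` columns of `A`, and `col l` is column `l` of `A` plus
  -- `y • col (l + 1)`.
  have hD_succ : ∀ l < s, D (col l) = y * D (col (l + 1)) := fun l hl => by
    have hcol : col l = (fun k => A k ⟨l, hl.trans s.lt_succ_self⟩) + y • col (l + 1) := by
      ext1 k
      change bilateral G _ = bilateral S _ + y * bilateral G _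
      rw [hG, bilateral_geom_mul, Nat.cast_succ, sub_sub]
    rw [hcol, map_add, map_smul, smul_eq_mul, add_eq_right]
    exact congrFun (Matrix.cramer_transpose_row_self A.transpose _) (Fin.last s) |>.trans <|
      Pi.single_eq_of_ne (Fin.ne_of_gt hl) _
  have hD : ∀ l ≤ s, D (col l) = y ^ (s - l) * D (col s) := fun l hl => by
    induction hl using Nat.decreasingInduction with
    | self => rw [Nat.sub_self, pow_zero, one_mul]
    | of_succ l hl ih =>
      rw [hD_succ l hl, ih, ← mul_assoc, ← pow_succ', ← Nat.sub_sub, Nat.sub_add_cancel (by omega)]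
  have hpow : (fun k => y ^ c k) = ∑ l ∈ Finset.range (s + 1), PowerSeries.coeff l P • col l := by
    ext1 k
    have hPG : P * G = PowerSeries.mk fun i => y ^ i := by rw [hG, mul_left_comm, hPS, mul_one]
    have hc := bilateral_mul (N := s + 1) (c := (c k : ℤ)) P G
      fun l hl => by rw [hP l hl, zero_mul]
    rw [hPG, bilateral_natCast, PowerSeries.coeff_mk] at hc
    rwa [Finset.sum_apply]
  rw [det_geom_mul_eq_det_updateCol, ← Matrix.cramer_apply, ← Matrix.cramer_apply]
  change _ * D (col s) = D _
  rw [hpow, map_sum, Finset.sum_mul]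
  refine Finset.sum_congr rfl fun l hl => ?_
  rw [map_smul, smul_eq_mul, hD l (Finset.mem_range_succ_iff.1 hl), mul_assoc]

theorem det_cons_pow {r : ℕ} (u : ℤ → R) {y z : R} (hyz : y * z = 1) (c : Fin r → ℕ) :
    Matrix.det (Matrix.of (Fin.cons (fun l => z ^ (l : ℕ))
      (fun k l => u ((c k : ℤ) - (l : ℤ))) : Fin (r + 1) → Fin (r + 1) → R)) =
    (-z) ^ r * Matrix.det (Matrix.of fun k l : Fin r =>
      u ((c k : ℤ) - (l : ℤ)) - y * u ((c k : ℤ) - (l : ℤ) - 1)) := by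
  let A : Matrix (Fin (r + 1)) (Fin (r + 1)) R :=
    Matrix.of (Fin.cons (fun l => z ^ (l : ℕ)) (fun k l => u ((c k : ℤ) - (l : ℤ))))
  let A' : Matrix (Fin (r + 1)) (Fin (r + 1)) R := Matrix.of fun k =>
    Fin.cons (A k 0) fun l => A k l.succ - z * A k l.castSucc
  have hdet : A.det = A'.det :=
    Matrix.det_eq_of_forall_col_eq_smul_add_pred (fun _ => z) (fun i => rfl) fun i j =>
      (sub_add_cancel (A i j.succ) _).symm
  have hminor : A'.submatrix Fin.succ (Fin.succAbove 0) = (-z) • Matrix.of fun k l : Fin r =>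
      u ((c k : ℤ) - (l : ℤ)) - y * u ((c k : ℤ) - (l : ℤ) - 1) := by
    ext1 k l
    change u ((c k : ℤ) - ((l.succ : ℕ) : ℤ)) - z * u ((c k : ℤ) - ((l.castSucc : ℕ) : ℤ)) =
      -z * (u ((c k : ℤ) - (l : ℤ)) - y * u ((c k : ℤ) - (l : ℤ) - 1))
    rw [Fin.val_succ, Fin.val_castSucc, Nat.cast_succ, ← sub_sub]
    linear_combination (-u ((c k : ℤ) - (l : ℤ) - 1)) * hyz
  have hzero : A' 0 0 = 1 := pow_zero z
  have hsucc : ∀ l : Fin r, A' 0 l.succ = 0 := fun l => by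
    change z ^ (l.succ : ℕ) - z * z ^ (l.castSucc : ℕ) = 0
    rw [Fin.val_succ, Fin.val_castSucc, pow_succ' z, sub_self]
  change A.det = _
  rw [hdet, Matrix.det_succ_row_zero, Fin.sum_univ_succ, Finset.sum_eq_zero fun l _ => by
    rw [hsucc, mul_zero, zero_mul], add_zero, hzero, hminor, Matrix.det_smul, Fintype.card_fin]
  simp

theorem schurDet_extend {r : ℕ} (mu : Fin r → ℕ) {g : ℤ → R} (h0 : g 0 = 1)
    (hneg : ∀ i < 0, g i = 0) : schurDet (extend mu) g = schurDet mu g := by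
  have hlast : extend mu (Fin.last r) = 0 := Fin.snoc_last (α := fun _ => ℕ) 0 mu
  have hcast : ∀ j : Fin r, extend mu j.castSucc = mu j :=
    fun j => Fin.snoc_castSucc (α := fun _ => ℕ) 0 mu j
  rw [schurDet, Matrix.det_succ_column _ (Fin.last r), Fin.sum_univ_castSucc,
    Finset.sum_eq_zero, zero_add, schurDet, Matrix.of_apply, hlast]
  · rw [Fin.val_last, ← two_mul, pow_mul, neg_one_sq, one_pow, one_mul, Nat.cast_zero, zero_sub,
      neg_add_cancel, h0, one_mul]
    congr 1
    ext1 i j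
    rw [Matrix.submatrix_apply, Fin.succAbove_last, Matrix.of_apply, Matrix.of_apply, hcast,
      Fin.val_castSucc, Fin.val_castSucc]
  · intro i _
    rw [Matrix.of_apply, hlast, hneg, mul_zero, zero_mul]
    rw [Fin.val_last, Fin.val_castSucc]
    omega

end Determinants

/-! ### Vertex operators -/

section VertexOperators

variable {R : Type*} [CommRing R]

/-- The ring homomorphism `B_s[z⁻¹] → R((z))` given by `π : B_s → R` on coefficients. For the
projection `π : B_s → B_{s,n}` it is `toLaurent s n`. -/
def laurentEval {s : ℕ} (π : B s →+* R) : Polynomial (B s) →+* LaurentSeries R :=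
  Polynomial.eval₂RingHom ((HahnSeries.C : R →+* LaurentSeries R).comp π)
    (HahnSeries.single (-1 : ℤ) (1 : R))

theorem laurentEval_C {s : ℕ} (π : B s →+* R) (p : B s) :
    laurentEval π (Polynomial.C p) = HahnSeries.C (π p) := by
  simp [laurentEval]

theorem laurentEval_X {s : ℕ} (π : B s →+* R) :
    laurentEval π Polynomial.X = HahnSeries.single (-1 : ℤ) 1 := by
  simp [laurentEval]

theorem laurentEval_sigmaMinusH {s : ℕ} (π : B s →+* R) (j : ℤ) :
    laurentEval π (sigmaMinusH s j) =
      bilateral (PowerSeries.mk (fun i => HahnSeries.single (-1 : ℤ) (1 : R) ^ i) *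
        PowerSeries.map (HahnSeries.C.comp π) (invE s)) j := by
  rw [sigmaMinusH_eq, sigmaSeq, map_bilateral, map_mul]
  congr 2 <;> ext1 i
  · rw [PowerSeries.coeff_map, PowerSeries.coeff_mk, PowerSeries.coeff_mk, map_pow, laurentEval_X]
  · simp_rw [PowerSeries.coeff_map, laurentEval_C, RingHom.comp_apply]

theorem laurentEval_sigmaBarSeq {s : ℕ} (π : B s →+* R) (j : ℤ) :
    laurentEval π (sigmaBarSeq s j) =
      HahnSeries.C (π (h s j)) - HahnSeries.single (-1 : ℤ) 1 * HahnSeries.C (π (h s (j - 1))) := by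
  rw [sigmaBarSeq, map_sub, map_mul, laurentEval_C, laurentEval_C, laurentEval_X]

theorem single_neg_one_pow (k : ℕ) :
    (HahnSeries.single (-1 : ℤ) (1 : R)) ^ k = HahnSeries.single (-(k : ℤ)) 1 := by
  rw [HahnSeries.single_pow, one_pow, nsmul_eq_mul, mul_neg_one]

theorem single_mul_single_neg_one_pow_mul_C (a : ℤ) (k : ℕ) (x : R) :
    HahnSeries.single a (1 : R) * (HahnSeries.single (-1 : ℤ) 1 ^ k * HahnSeries.C x) =
      HahnSeries.single (a - k) x := by
  rw [single_neg_one_pow, HahnSeries.C_apply, HahnSeries.single_mul_single,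
    HahnSeries.single_mul_single, one_mul, one_mul, add_zero, ← sub_eq_add_neg]

theorem ofPowerSeries_eq_single_mul_sum {s : ℕ} {P : PowerSeries R}
    (hP : ∀ l, s < l → PowerSeries.coeff l P = 0) :
    HahnSeries.ofPowerSeries ℤ R P = HahnSeries.single (s : ℤ) 1 *
      ∑ l ∈ Finset.range (s + 1),
        HahnSeries.C (PowerSeries.coeff l P) * HahnSeries.single (-1 : ℤ) 1 ^ (s - l) := by
  have hsum : P = ∑ l ∈ Finset.range (s + 1),
      PowerSeries.C (PowerSeries.coeff l P) * PowerSeries.X ^ l := by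
    ext j
    simp_rw [map_sum, PowerSeries.coeff_C_mul, PowerSeries.coeff_X_pow, mul_ite, mul_one, mul_zero,
      Finset.sum_ite_eq]
    split_ifs with hj
    · rfl
    · exact hP j (by simpa using hj)
  conv_lhs => rw [hsum]
  rw [map_sum, Finset.mul_sum]
  refine Finset.sum_congr rfl fun l hl => ?_
  rw [mul_comm (HahnSeries.C _), single_mul_single_neg_one_pow_mul_C, map_mul,
    HahnSeries.ofPowerSeries_C, HahnSeries.ofPowerSeries_X_pow, HahnSeries.C_apply,
    HahnSeries.single_mul_single, zero_add, mul_one,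
    Nat.cast_sub (Finset.mem_range_succ_iff.1 hl), sub_sub_cancel]

/-- The series `(-1)^s ∑_{i < n} π(φ_s⁻¹(β_i ⌟ x)) z^{s-i}`, where `β_i` is the form dual to `b_i`:
the generating series of the contractions of `x`, cut off at `n`. -/
def loweringSeries {s : ℕ} (π : B s →+* R) (n : ℕ) (x : Ext) : LaurentSeries R :=
  (-1) ^ s * ∑ i ∈ Finset.range n,
    HahnSeries.single ((s : ℤ) - i) (π (phiInv s (contract (bBasis.coord i) x)))

/-- The series `(-1)^r ∑_{i ≥ 0} ρ(φ_{r+1}⁻¹(b_i ∧ x)) z^{i-r}`: the generating series of the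
products of the `b_i` with `x`. -/
def raisingSeries {r : ℕ} (ρ : B (r + 1) →+* R) (x : Ext) : LaurentSeries R :=
  (-1) ^ r * (HahnSeries.single (-(r : ℤ)) 1 * HahnSeries.ofPowerSeries ℤ R
    (PowerSeries.mk fun i => ρ (phiInv (r + 1) (ExteriorAlgebra.ι ℤ (b i) * x))))

theorem sum_mul_phiInv_contract_ιMulti {s n : ℕ} {c : Fin (s + 1) → ℕ} (hc : ∀ k, c k < n)
    (f : B s →+* R) (y : ℕ → R) :
    ∑ i ∈ Finset.range n, y i * f (phiInv s (contract (bBasis.coord i)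
      (ExteriorAlgebra.ιMulti ℤ (s + 1) fun k => b (c k)))) =
    (-1) ^ s * Matrix.det ((Matrix.of fun k l : Fin (s + 1) =>
      f (h s ((c k : ℤ) - (l : ℤ)))).updateCol (Fin.last s) fun k => y (c k)) := by
  rw [Matrix.det_succ_column _ (Fin.last s), Finset.mul_sum]
  simp_rw [contract_ιMulti, map_sum, Finset.mul_sum]
  rw [Finset.sum_comm]
  refine Finset.sum_congr rfl fun k _ => ?_
  rw [Finset.sum_eq_single_of_mem (c k) (Finset.mem_range.2 (hc k))]
  · rw [bBasis_coord_b, if_pos rfl, mul_one, map_smul, phiInv_ιMulti_b fun j => c (k.succAbove j),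
      map_zsmul, RingHom.map_det, Matrix.updateCol_self, Matrix.submatrix_updateCol_succAbove,
      Fin.succAbove_last, Fin.val_last, zsmul_eq_mul, Int.cast_pow, Int.cast_neg, Int.cast_one,
      add_comm (k : ℕ), pow_add, ← mul_assoc, ← mul_assoc, ← mul_assoc, ← mul_assoc, ← mul_pow,
      neg_one_mul, neg_neg, one_pow, one_mul, mul_comm (y _)]
    rfl
  · intro i _ hi
    rw [bBasis_coord_b, if_neg hi.symm, mul_zero, zero_smul, map_zero, map_zero, mul_zero]

theorem E_mul_schurDet_sigmaMinusH {s n : ℕ} (π : B s →+* R) {lam : Fin (s + 1) → ℕ}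
    (hlam : ∀ k : Fin (s + 1), (k : ℕ) + lam k.rev < n) :
    HahnSeries.ofPowerSeries ℤ R (PowerSeries.map π (E s)) *
      schurDet lam (fun j => laurentEval π (sigmaMinusH s j)) =
    loweringSeries π n (wedge lam : Ext) := by
  let f : B s →+* LaurentSeries R := HahnSeries.C.comp π
  let y : LaurentSeries R := HahnSeries.single (-1 : ℤ) 1
  have hborder := sum_mul_det_geom_mul (P := PowerSeries.map f (E s))
    (S := PowerSeries.map f (invE s)) (by rw [← map_mul, E_mul_invE, map_one])
    (fun l hl => by rw [PowerSeries.coeff_map, coeff_E_of_lt hl, map_zero]) y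
    (fun k => k + lam k.rev)
  have hcontract := sum_mul_phiInv_contract_ιMulti (c := fun k => k + lam k.rev) hlam f (y ^ ·)
  have hsq : (-1 : LaurentSeries R) ^ s * (-1) ^ s = 1 := by rw [← mul_pow]; simp
  have hbilateral : ∀ j, f (h s j) = bilateral (PowerSeries.map f (invE s)) j :=
    map_bilateral f (invE s)
  simp_rw [hbilateral, ← hborder] at hcontract
  rw [ofPowerSeries_eq_single_mul_sum fun l hl => by
    rw [PowerSeries.coeff_map, coeff_E_of_lt hl, map_zero], schurDet_eq_det]
  simp_rw [laurentEval_sigmaMinusH, PowerSeries.coeff_map] at hcontract ⊢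
  rw [loweringSeries, wedge, exteriorPower.ιMulti_apply_coe]
  simp_rw [← single_mul_single_neg_one_pow_mul_C, ← Finset.mul_sum]
  change _ = (-1) ^ s * (_ * ∑ i ∈ Finset.range n, y ^ i * f _)
  rw [hcontract, mul_left_comm (HahnSeries.single _ _), ← mul_assoc ((-1) ^ s), hsq, one_mul,
    mul_assoc]
  rfl

theorem coeff_X_pow_mul_eq_bilateral (P : PowerSeries R) (i l : ℕ) :
    PowerSeries.coeff i (PowerSeries.X ^ l * P) = bilateral P ((i : ℤ) - l) := by
  rw [PowerSeries.coeff_X_pow_mul']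
  split_ifs with hl
  · rw [← Nat.cast_sub hl, bilateral_natCast]
  · rw [bilateral_of_neg _ (by omega)]

theorem mk_phiInv_ι_mul_ιMulti {r : ℕ} (ρ : B (r + 1) →+* R) (c : Fin r → ℕ) :
    PowerSeries.mk (fun i => ρ (phiInv (r + 1) (ExteriorAlgebra.ι ℤ (b i) *
      ExteriorAlgebra.ιMulti ℤ r fun k => b (c k)))) =
    PowerSeries.map ρ (invE (r + 1)) * Matrix.det (Matrix.of (Fin.cons
      (fun l => PowerSeries.X ^ (l : ℕ))
      (fun k l => PowerSeries.C (ρ (h (r + 1) ((c k : ℤ) - (l : ℤ))))) :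
        Fin (r + 1) → Fin (r + 1) → PowerSeries R)) := by
  have hdet : ∀ i, phiInv (r + 1) (ExteriorAlgebra.ι ℤ (b i) *
      ExteriorAlgebra.ιMulti ℤ r fun k => b (c k)) = Matrix.det (Matrix.of
        fun k l : Fin (r + 1) => h (r + 1) (((Fin.cons i c : Fin (r + 1) → ℕ) k : ℤ) - l)) :=
    fun i => by
      rw [← phiInv_ιMulti_b, ExteriorAlgebra.ιMulti_succ_apply]
      rfl
  ext i
  rw [PowerSeries.coeff_mk, hdet, Matrix.det_succ_row_zero, Matrix.det_succ_row_zero, map_sum,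
    Finset.mul_sum, map_sum]
  refine Finset.sum_congr rfl fun l _ => ?_
  have hminor : Matrix.det ((Matrix.of (Fin.cons (fun l => PowerSeries.X ^ (l : ℕ))
      (fun k l => PowerSeries.C (ρ (h (r + 1) ((c k : ℤ) - (l : ℤ))))) :
        Fin (r + 1) → Fin (r + 1) → PowerSeries R)).submatrix Fin.succ l.succAbove) =
      PowerSeries.C (ρ (Matrix.det ((Matrix.of fun k l : Fin (r + 1) =>
        h (r + 1) (((Fin.cons i c : Fin (r + 1) → ℕ) k : ℤ) - l)).submatrix
          Fin.succ l.succAbove))) := by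
    rw [RingHom.map_det, RingHom.map_det]
    rfl
  have hcoeff (d : R) : PowerSeries.coeff i (PowerSeries.map ρ (invE (r + 1)) *
      ((-1) ^ (l : ℕ) * PowerSeries.X ^ (l : ℕ) * PowerSeries.C d)) =
      (-1) ^ (l : ℕ) * ρ (h (r + 1) ((i : ℤ) - l)) * d := by
    have hsign : ((-1) ^ (l : ℕ) : PowerSeries R) = PowerSeries.C ((-1) ^ (l : ℕ)) := by simp
    rw [mul_comm, mul_right_comm, PowerSeries.coeff_mul_C, hsign, mul_assoc,
      PowerSeries.coeff_C_mul, coeff_X_pow_mul_eq_bilateral, ← map_bilateral]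
    rfl
  rw [hminor, map_mul, map_mul, map_pow, map_neg, map_one]
  exact (hcoeff _).symm

theorem schurDet_laurentEval_sigmaBarMinusH {r : ℕ} (ρ : B (r + 1) →+* R) (mu : Fin r → ℕ) :
    schurDet (extend mu) (fun j => laurentEval ρ (sigmaBarMinusH (r + 1) j)) =
      Matrix.det (Matrix.of fun k l : Fin r =>
        HahnSeries.C (ρ (h (r + 1) (((k + mu k.rev : ℕ) : ℤ) - (l : ℤ)))) -
          HahnSeries.single (-1 : ℤ) 1 *
            HahnSeries.C (ρ (h (r + 1) (((k + mu k.rev : ℕ) : ℤ) - (l : ℤ) - 1)))) := by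
  simp_rw [sigmaBarMinusH_eq]
  rw [schurDet_extend, schurDet_eq_det]
  · simp_rw [laurentEval_sigmaBarSeq]
  · rw [sigmaBarSeq_zero, map_one]
  · intro i hi
    rw [sigmaBarSeq_of_neg hi, map_zero]

theorem invE_mul_schurDet_sigmaBarMinusH {r : ℕ} (ρ : B (r + 1) →+* R) (mu : Fin r → ℕ) :
    HahnSeries.ofPowerSeries ℤ R (PowerSeries.map ρ (invE (r + 1))) *
      schurDet (extend mu) (fun j => laurentEval ρ (sigmaBarMinusH (r + 1) j)) =
    raisingSeries ρ (wedge mu : Ext) := by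
  let u (j : ℤ) : LaurentSeries R := HahnSeries.C (ρ (h (r + 1) j))
  let y : LaurentSeries R := HahnSeries.single (-1 : ℤ) 1
  let z : LaurentSeries R := HahnSeries.single (1 : ℤ) 1
  have hyz : y * z = 1 := by simp [y, z]
  have hrows : HahnSeries.ofPowerSeries ℤ R (PowerSeries.mk fun i =>
      ρ (phiInv (r + 1) (ExteriorAlgebra.ι ℤ (b i) * (wedge mu : Ext)))) =
      HahnSeries.ofPowerSeries ℤ R (PowerSeries.map ρ (invE (r + 1))) * Matrix.det (Matrix.of
        (Fin.cons (fun l => z ^ (l : ℕ)) (fun k l => u (((k + mu k.rev : ℕ) : ℤ) - (l : ℤ))) :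
          Fin (r + 1) → Fin (r + 1) → LaurentSeries R)) := by
    rw [wedge, exteriorPower.ιMulti_apply_coe, mk_phiInv_ι_mul_ιMulti ρ fun k => k + mu k.rev,
      map_mul, RingHom.map_det]
    congr 2
    ext1 k l
    refine Fin.cases ?_ (fun k => ?_) k
    · simp [z]
    · simp [u]
  have hsign : (-1) ^ r * (y ^ r * (-z) ^ r) = 1 := by
    rw [← mul_pow, ← mul_pow, mul_neg, hyz, neg_one_mul, neg_neg, one_pow]
  rw [raisingSeries, hrows, det_cons_pow u hyz fun k : Fin r => (k : ℕ) + mu k.rev,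
    ← schurDet_laurentEval_sigmaBarMinusH, ← single_neg_one_pow]
  linear_combination (-(HahnSeries.ofPowerSeries ℤ R (PowerSeries.map ρ (invE (r + 1))) *
    schurDet (extend mu) fun j => laurentEval ρ (sigmaBarMinusH (r + 1) j))) * hsign

end VertexOperators

/-! ### The residue pairing -/

section Residue

variable {R S T : Type*} [CommRing R] [CommRing S] [CommRing T]

/-- A ring homomorphism acting on the coefficients of Laurent series. The maps `left` and `right`
are of this form. -/
def laurentMap (f : R →+* T) : LaurentSeries R →+* LaurentSeries T where
  toFun x := HahnSeries.map x f
  map_one' := HahnSeries.map_one f.toMonoidWithZeroHom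
  map_mul' _ _ := HahnSeries.map_mul (f : R →ₙ+* T)
  map_zero' := HahnSeries.map_zero (f : ZeroHom R T)
  map_add' _ _ := HahnSeries.map_add (f : R →+ T)

theorem laurentMap_single (f : R →+* T) (i : ℤ) (a : R) :
    laurentMap f (HahnSeries.single i a) = HahnSeries.single i (f a) :=
  HahnSeries.map_single (f : ZeroHom R T)

theorem left_eq_laurentMap :
    left R S = laurentMap (Algebra.TensorProduct.includeLeft : R →ₐ[ℤ] R ⊗[ℤ] S).toRingHom := rfl

theorem left_mul (x y : LaurentSeries R) : left R S (x * y) = left R S x * left R S y :=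
  map_mul (laurentMap _) x y

theorem right_mul (x y : LaurentSeries S) : right R S (x * y) = right R S x * right R S y :=
  map_mul (laurentMap _) x y

theorem mul_mul_sum_sum_smul_mul {ι κ : Type*} (J : Finset ι) (K : Finset κ) (c : ι → κ → ℤ)
    (x y : R) (f : ι → R) (g : κ → R) :
    x * y * ∑ j ∈ J, ∑ k ∈ K, c j k • (f j * g k) =
      ∑ j ∈ J, ∑ k ∈ K, c j k • (x * f j * (y * g k)) := by
  simp_rw [Finset.mul_sum, mul_smul_comm, mul_mul_mul_comm]

theorem left_mul_right_mul_sum_sum {ι κ : Type*} (J : Finset ι) (K : Finset κ) (c : ι → κ → ℤ)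
    (x : LaurentSeries R) (y : LaurentSeries S) (f : ι → LaurentSeries R)
    (g : κ → LaurentSeries S) :
    left R S x * right R S y * ∑ j ∈ J, ∑ k ∈ K, c j k • (left R S (f j) * right R S (g k)) =
      ∑ j ∈ J, ∑ k ∈ K, c j k • tens (x * f j) (y * g k) := by
  simp_rw [tens, left_mul, right_mul]
  exact mul_mul_sum_sum_smul_mul J K c (left R S x) (right R S y) (fun j => left R S (f j))
    fun k => right R S (g k)

theorem res_single_mul (k : ℤ) (a : R) (g : LaurentSeries R) :
    res (HahnSeries.single k a * g) = a * g.coeff (-1 - k) := by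
  conv_lhs => rw [res, ← sub_add_cancel (-1) k]
  exact HahnSeries.coeff_single_mul_add

theorem res_tens_sum_single {ι : Type*} (J : Finset ι) (k : ι → ℤ) (a : ι → R)
    (g : LaurentSeries S) :
    res (tens (∑ i ∈ J, HahnSeries.single (k i) (a i)) g) =
      ∑ i ∈ J, a i ⊗ₜ[ℤ] g.coeff (-1 - k i) := by
  have hsum : tens (∑ i ∈ J, HahnSeries.single (k i) (a i)) g =
      ∑ i ∈ J, tens (HahnSeries.single (k i) (a i)) g := by
    simp only [tens, left_eq_laurentMap, map_sum]
    exact Finset.sum_mul J _ (right R S g)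
  rw [hsum, res, HahnSeries.coeff_sum]
  refine Finset.sum_congr rfl fun i _ => ?_
  change res _ = _
  rw [tens, left_eq_laurentMap, laurentMap_single, res_single_mul]
  exact (Algebra.TensorProduct.tmul_mul_tmul (a i) 1 1 _).trans (by rw [mul_one, one_mul])

theorem coeff_raisingSeries {r : ℕ} (ρ : B (r + 1) →+* R) (y : Ext) (i : ℕ) :
    (raisingSeries ρ y).coeff (i - r) =
      (-1) ^ r * ρ (phiInv (r + 1) (ExteriorAlgebra.ι ℤ (b i) * y)) := by
  have hsign : ((-1) ^ r : LaurentSeries R) = HahnSeries.C ((-1) ^ r) := by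
    rw [map_pow, map_neg, map_one]
  rw [raisingSeries, hsign, HahnSeries.C_mul_eq_smul, HahnSeries.coeff_smul, sub_eq_add_neg,
    HahnSeries.coeff_single_mul_add, LaurentSeries.coeff_coe_powerSeries, PowerSeries.coeff_mk,
    one_mul, smul_eq_mul]

theorem res_tens_loweringSeries_raisingSeries {s : ℕ} (π : B s →+* R) (ρ : B (s + 2) →+* S)
    (n : ℕ) (x y : Ext) :
    res (tens (loweringSeries π n x) (raisingSeries ρ y)) =
      -∑ i ∈ Finset.range n, π (phiInv s (contract (bBasis.coord i) x)) ⊗ₜ[ℤ]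
        ρ (phiInv (s + 2) (ExteriorAlgebra.ι ℤ (b i) * y)) := by
  have hlowering : loweringSeries π n x = ∑ i ∈ Finset.range n, HahnSeries.single ((s : ℤ) - i)
      ((-1) ^ s * π (phiInv s (contract (bBasis.coord i) x))) := by
    have hsign : ((-1) ^ s : LaurentSeries R) = HahnSeries.C ((-1) ^ s) := by
      rw [map_pow, map_neg, map_one]
    rw [loweringSeries, hsign, Finset.mul_sum]
    simp only [HahnSeries.C_apply, HahnSeries.single_mul_single, zero_add]
  rw [hlowering, res_tens_sum_single, ← Finset.sum_neg_distrib]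
  refine Finset.sum_congr rfl fun i _ => ?_
  have hindex : (-1 - ((s : ℤ) - i) : ℤ) = (i : ℤ) - ((s + 1 : ℕ) : ℤ) := by push_cast; ring
  rw [hindex, coeff_raisingSeries, pow_succ]
  rcases s.even_or_odd with hs | hs <;>
    simp only [hs.neg_one_pow, one_mul, neg_mul, neg_neg, TensorProduct.tmul_neg,
      TensorProduct.neg_tmul]

end Residue

/-! ### The residue as a Plücker form -/

theorem pluckerForm_sum_smul_sum_smul (s n : ℕ) {ι κ : Type*} (J : Finset ι) (K : Finset κ)
    (a : ι → ℤ) (c : κ → ℤ) (x : ι → Ext) (y : κ → Ext) :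
    pluckerForm s n (∑ j ∈ J, a j • x j) (∑ k ∈ K, c k • y k) =
      ∑ j ∈ J, ∑ k ∈ K, (a j * c k) • pluckerForm s n (x j) (y k) := by
  simp_rw [pluckerForm, Finset.mul_sum, mul_smul_comm, map_sum, map_zsmul, TensorProduct.sum_tmul,
    TensorProduct.tmul_sum, TensorProduct.smul_tmul_smul, Finset.smul_sum]
  rw [Finset.sum_comm]
  exact Finset.sum_congr rfl fun j _ => Finset.sum_comm

theorem isDecomposable_iff_pluckerForm_eq_zero {s n : ℕ} {m : ⋀[ℤ]^(s + 1) M0}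
    (hm : (m : Ext) ∈ supported bBasis (Finset.range n)) :
    IsDecomposable m ↔ pluckerForm s n (m : Ext) (m : Ext) = 0 := by
  rw [← pluckerTensor_eq_zero_iff_pluckerForm m.2 hm,
    ← exists_ιMulti_eq_iff_pluckerTensor_eq_zero bBasis m.2]
  exact exists_congr fun v => Subtype.ext_iff

theorem add_lt_of_mem_boundedPartitions {r n : ℕ} {lam : Fin r → ℕ}
    (hlam : lam ∈ boundedPartitions r n) (k : Fin r) : (k : ℕ) + lam k.rev < n := by
  have := (Finset.mem_filter.1 hlam).2.2 k.rev
  omega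

theorem sum_smul_wedge_mem_supported {r n : ℕ} (a : (Fin r → ℕ) → ℤ) :
    ((∑ lam ∈ boundedPartitions r n, a lam • wedge lam : ⋀[ℤ]^r M0) : Ext) ∈
      supported bBasis (Finset.range n) := by
  rw [Submodule.coe_sum]
  refine Submodule.sum_mem _ fun lam hlam => Submodule.smul_mem _ _ ?_
  rw [wedge, exteriorPower.ιMulti_apply_coe]
  simp_rw [← bBasis_apply]
  exact ιMulti_basis_mem_supported fun k =>
    Finset.mem_range.2 (add_lt_of_mem_boundedPartitions hlam k)

theorem res_tens_schurDet {s n : ℕ} {lam : Fin (s + 1) → ℕ}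
    (hlam : lam ∈ boundedPartitions (s + 1) n) (mu : Fin (s + 1) → ℕ) :
    res (tens (ET s n * schurDet lam (sigmaMinusHT s n))
      (invET (s + 2) n * schurDet (extend mu) (sigmaBarMinusHT (s + 2) n))) =
      -pluckerForm s n (wedge lam : Ext) (wedge mu : Ext) := by
  rw [pluckerForm, ← res_tens_loweringSeries_raisingSeries,
    ← E_mul_schurDet_sigmaMinusH _ (add_lt_of_mem_boundedPartitions hlam),
    ← invE_mul_schurDet_sigmaBarMinusH]
  rfl

theorem res_sum_tens_schurDet (s n : ℕ) (a : (Fin (s + 1) → ℕ) → ℤ) {m : ⋀[ℤ]^(s + 1) M0}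
    (hm : m = ∑ lam ∈ boundedPartitions (s + 1) n, a lam • wedge lam) :
    res (∑ lam ∈ boundedPartitions (s + 1) n, ∑ mu ∈ boundedPartitions (s + 1) n,
      (a lam * a mu) • tens (ET s n * schurDet lam (sigmaMinusHT s n))
        (invET (s + 2) n * schurDet (extend mu) (sigmaBarMinusHT (s + 2) n))) =
      -pluckerForm s n (m : Ext) (m : Ext) := by
  have hcoe : (m : Ext) = ∑ lam ∈ boundedPartitions (s + 1) n, a lam • (wedge lam : Ext) := by
    simp [hm]
  rw [hcoe, pluckerForm_sum_smul_sum_smul]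
  simp_rw [res, HahnSeries.coeff_sum, HahnSeries.coeff_smul, ← Finset.sum_neg_distrib, ← smul_neg]
  refine Finset.sum_congr rfl fun lam hlam => Finset.sum_congr rfl fun mu _ => ?_
  rw [← res_tens_schurDet hlam mu, res]

theorem left_mul_right_mul_sum (s n : ℕ) (a : (Fin (s + 1) → ℕ) → ℤ) :
    left (BT s n) (BT (s + 2) n) (ET s n) * right (BT s n) (BT (s + 2) n) (invET (s + 2) n) *
      ∑ lam ∈ boundedPartitions (s + 1) n, ∑ mu ∈ boundedPartitions (s + 1) n,
        (a lam * a mu) • (left (BT s n) (BT (s + 2) n) (schurDet lam (sigmaMinusHT s n)) *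
          right (BT s n) (BT (s + 2) n) (toLaurent (s + 2) n
            (sigmaBarMinusB (s + 2) (schurDet (extend mu) (h (s + 2)))))) =
    ∑ lam ∈ boundedPartitions (s + 1) n, ∑ mu ∈ boundedPartitions (s + 1) n,
      (a lam * a mu) • tens (ET s n * schurDet lam (sigmaMinusHT s n))
        (invET (s + 2) n * schurDet (extend mu) (sigmaBarMinusHT (s + 2) n)) := by
  have hbar (mu : Fin (s + 1) → ℕ) :
      toLaurent (s + 2) n (sigmaBarMinusB (s + 2) (schurDet (extend mu) (h (s + 2)))) =
        schurDet (extend mu) (sigmaBarMinusHT (s + 2) n) := by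
    change laurentEval (proj (s + 2) n) _ = _
    rw [sigmaBarMinusB_schurDet, ← funext (sigmaBarMinusH_eq _), map_schurDet (laurentEval _)]
    rfl
  simp_rw [hbar]
  exact left_mul_right_mul_sum_sum ..

end

end SchubertDerivation

theorem mainTheorem8 (r n : ℕ) (hr : 1 ≤ r) (a : (Fin r → ℕ) → ℤ) :
    (IsDecomposable (∑ lam ∈ boundedPartitions r n, a lam • wedge lam) ↔
      res (∑ lam ∈ boundedPartitions r n, ∑ mu ∈ boundedPartitions r n,
        (a lam * a mu) •
          tens (ET (r - 1) n * schurDet lam (sigmaMinusHT (r - 1) n))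
            (invET (r + 1) n * schurDet (extend mu) (sigmaBarMinusHT (r + 1) n))) = 0) ∧
    (IsDecomposable (∑ lam ∈ boundedPartitions r n, a lam • wedge lam) ↔
      res (left (BT (r - 1) n) (BT (r + 1) n) (ET (r - 1) n) *
          right (BT (r - 1) n) (BT (r + 1) n) (invET (r + 1) n) *
        ∑ lam ∈ boundedPartitions r n, ∑ mu ∈ boundedPartitions r n,
          (a lam * a mu) •
            (left (BT (r - 1) n) (BT (r + 1) n) (schurDet lam (sigmaMinusHT (r - 1) n)) *
              right (BT (r - 1) n) (BT (r + 1) n)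
                (toLaurent (r + 1) n
                  (sigmaBarMinusB (r + 1) (schurDet (extend mu) (h (r + 1))))))) = 0) := by
  obtain ⟨s, rfl⟩ := Nat.exists_eq_add_of_le' hr
  have hdecomposable := isDecomposable_iff_pluckerForm_eq_zero
    (sum_smul_wedge_mem_supported (n := n) a)
  rw [← neg_eq_zero, ← res_sum_tens_schurDet s n a rfl] at hdecomposable
  refine ⟨hdecomposable, hdecomposable.trans ?_⟩
  rw [← left_mul_right_mul_sum]
  rfl
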